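/- Let $d\in\{2,3\}$, $s\in(1/2,1)$ and $\nu_1>0$. For a (nondegenerate) $d$-simplex $K\subset\mathbb R^d$ let $h_K$ be its diameter and $\rho_K$ the diameter of the largest ball contained in $K$; for a face $e\subset\partial K$ (an edge if $d=2$) let $h_e$ be its diameter. On (the interior of) $K$ put $$|v|_{H^1(K)}^2=\sum_{i=1}^d\|\partial_i v\|_{L^2(K)}^2,\qquad |v|_{H^{1+s}(K)}^2=\sum_{i=1}^d\iint_{K\times K}\frac{|\partial_i v(x)-\partial_i v(y)|^2}{|x-y|^{d+2s}}\,dx\,dy,$$ with weak derivatives $\partial_i v$, and $H^{1+s}(K)=\{v\in H^1(K): |v|_{H^{1+s}(K)}<\infty\}$ (real-valued functions). There is a constant $C>0$, depending only on $d$, $s$ and $\nu_1$, such that for every $d$-simplex $K$ satisfying $$\max\Big\{\frac{h_{e'}}{\rho_K},\frac{h_K}{h_{e'}}\Big\}\le\nu_1\qquad\text{for all faces } e'\subset\partial K,$$ every face $e$ of $K$ and every $v\in H^{1+s}(K)$, the gradient $\nabla v$ has a trace on $e$ in $L^2(e)^d$ and $$\|\nabla v\|_{L^2(e)}^2\le C\,h_e^{-1}\left(|v|_{H^1(K)}^2+h_K^{2s}|v|_{H^{1+s}(K)}^2\right).$$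 In particular, $C$ is the same for all elements $K$ of all triangulations of a family whose elements satisfy this condition with a common $\nu_1$. Here the trace on $e$ is the componentwise continuous extension, from functions smooth up to the boundary to $H^s(K)=\{w\in L^2(K): |w|_{H^s(K)}^2=\iint_{K\times K}|w(x)-w(y)|^2|x-y|^{-d-2s}\,dx\,dy<\infty\}$, of the restriction $w\mapsto w|_e$; $L^2(e)$ is taken with respect to surface measure. -/

import Mathlib

open MeasureTheory Filter Topology
open scoped ENNReal ContDiff

noncomputable section

namespace TraceIneq

/-- The Euclidean space `ℝ^d`. -/
abbrev Euc (d : ℕ) : Type := EuclideanSpace ℝ (Fin d)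

/-! ### Simplicial elements and their faces -/

/-- The closed `d`-simplex in `ℝ^d` with the given (affinely independent) vertices. -/
def body {d : ℕ} (K : Affine.Simplex ℝ (Euc d) d) : Set (Euc d) :=
  convexHull ℝ (Set.range K.points)

/-- The open simplex, the domain on which the Sobolev spaces of the element are taken. -/
def elem {d : ℕ} (K : Affine.Simplex ℝ (Euc d) d) : Set (Euc d) :=
  interior (body K)

/-- The (closed) face of the simplex opposite to the vertex `i`: an edge if `d = 2`, a triangle if
`d = 3`. -/
def face {d : ℕ} (K : Affine.Simplex ℝ (Euc d) d) (i : Fin (d + 1)) : Set (Euc d) :=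
  convexHull ℝ (K.points '' {j | j ≠ i})

/-- Surface measure on a face: the `(d - 1)`-dimensional Hausdorff measure, normalised so that it
is the usual length (`d = 2`) or area (`d = 3`). -/
def faceMeasure {d : ℕ} (K : Affine.Simplex ℝ (Euc d) d) (i : Fin (d + 1)) : Measure (Euc d) :=
  (Measure.euclideanHausdorffMeasure (d - 1)).restrict (face K i)

/-- `h_K`, the diameter of the element. -/
def elemDiam {d : ℕ} (K : Affine.Simplex ℝ (Euc d) d) : ℝ :=
  Metric.diam (body K)

/-- `h_e`, the diameter of a face. -/
def faceDiam {d : ℕ} (K : Affine.Simplex ℝ (Euc d) d) (i : Fin (d + 1)) : ℝ :=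
  Metric.diam (face K i)

/-- `ρ_K`, the diameter of the largest ball contained in the element. -/
def inscribedDiam {d : ℕ} (K : Affine.Simplex ℝ (Euc d) d) : ℝ :=
  2 * sSup {r : ℝ | 0 ≤ r ∧ ∃ x, Metric.ball x r ⊆ body K}

/-- The mesh condition with constant `ν`:
`max {h_e / ρ_K, h_K / h_e} ≤ ν` for every face `e` of `K`. -/
def MeshRegular {d : ℕ} (ν : ℝ) (K : Affine.Simplex ℝ (Euc d) d) : Prop :=
  ∀ i, max (faceDiam K i / inscribedDiam K) (elemDiam K / faceDiam K i) ≤ ν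

/-! ### Sobolev spaces -/

/-- The squared `L²` norm with respect to `μ`, with values in `[0, ∞]`. -/
def l2Sq {d : ℕ} (μ : Measure (Euc d)) (w : Euc d → ℝ) : ℝ≥0∞ :=
  ∫⁻ x, ENNReal.ofReal (w x ^ 2) ∂μ

/-- The squared Gagliardo seminorm
`|w|²_{H^s(U)} = ∬_{U × U} |w x - w y|² / |x - y|^{d + 2 s} dx dy`, with values in `[0, ∞]`. -/
def gagliardoSq {d : ℕ} (s : ℝ) (U : Set (Euc d)) (w : Euc d → ℝ) : ℝ≥0∞ :=
  ∫⁻ p : Euc d × Euc d,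
    ENNReal.ofReal ((w p.1 - w p.2) ^ 2 / ‖p.1 - p.2‖ ^ ((d : ℝ) + 2 * s))
    ∂((volume.restrict U).prod (volume.restrict U))

/-- `g ∈ L²(U)` is the weak partial derivative `∂_i v` on the open set `U`. -/
def HasWeakPartial {d : ℕ} (U : Set (Euc d)) (i : Fin d) (v g : Euc d → ℝ) : Prop :=
  MemLp g 2 (volume.restrict U) ∧
  ∀ φ : Euc d → ℝ, ContDiff ℝ ∞ φ → HasCompactSupport φ → tsupport φ ⊆ U →
    ∫ x in U, v x * fderiv ℝ φ x (EuclideanSpace.single i 1) = - ∫ x in U, g x * φ x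

/-- `v ∈ H¹(U)`. -/
def MemH1 {d : ℕ} (U : Set (Euc d)) (v : Euc d → ℝ) : Prop :=
  MemLp v 2 (volume.restrict U) ∧ ∀ i, ∃ g, HasWeakPartial U i v g

open Classical in
/-- The weak partial derivative `∂_i v ∈ L²(U)` (determined almost everywhere on `U`); it is only
used for `v ∈ H¹(U)`. -/
def weakPartial {d : ℕ} (U : Set (Euc d)) (i : Fin d) (v : Euc d → ℝ) : Euc d → ℝ :=
  if h : ∃ g, HasWeakPartial U i v g then h.choose else 0

/-- `|v|²_{H¹(U)} = ∑_i ‖∂_i v‖²_{L²(U)}`. -/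
def h1SeminormSq {d : ℕ} (U : Set (Euc d)) (v : Euc d → ℝ) : ℝ≥0∞ :=
  ∑ i, l2Sq (volume.restrict U) (weakPartial U i v)

/-- `|v|²_{H^{1+s}(U)} = ∑_i |∂_i v|²_{H^s(U)}`. -/
def h1sSeminormSq {d : ℕ} (s : ℝ) (U : Set (Euc d)) (v : Euc d → ℝ) : ℝ≥0∞ :=
  ∑ i, gagliardoSq s U (weakPartial U i v)

/-- `v ∈ H^{1+s}(U)`. -/
def MemH1s {d : ℕ} (s : ℝ) (U : Set (Euc d)) (v : Euc d → ℝ) : Prop :=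
  MemH1 U v ∧ h1sSeminormSq s U v < ⊤

/-! ### Traces -/

/-- `g ∈ L²(μ)` is the trace of `w ∈ H^s(U)` on the part of the boundary of `U` carrying the
surface measure `μ`: the value at `w` of the continuous extension to `H^s(U)` of the restriction
map, defined on functions smooth up to the boundary. That is, `w` is the limit in `H^s(U)` of
smooth functions whose restrictions converge to `g` in `L²(μ)`. -/
def IsTrace {d : ℕ} (s : ℝ) (U : Set (Euc d)) (μ : Measure (Euc d)) (w g : Euc d → ℝ) : Prop :=
  MemLp g 2 μ ∧
  ∃ φ : ℕ → Euc d → ℝ, (∀ n, ContDiff ℝ ∞ (φ n)) ∧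
    Tendsto (fun n => l2Sq (volume.restrict U) (w - φ n) + gagliardoSq s U (w - φ n))
      atTop (𝓝 0) ∧
    Tendsto (fun n => l2Sq μ (g - φ n)) atTop (𝓝 0)

end TraceIneq

end

namespace TraceIneq

/-! ### Squared `L²` norms -/

/-! The estimate is applied to each weak partial derivative separately, so the core is a scaled
trace inequality for one function `w` in `H^s` of a bounded convex open set `U`, with a measure `σ`
on the closure of `U` satisfying `σ(B(y,r)) ≤ M r^(d-1)`.

For continuous `φ`, a boundary point `x` and `y ∈ U`, the values `φ(x + 2^(-k) (y - x))` run from `φ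
y` at `k = 0` to `φ x` as `k → ∞`. The `L²` distance between consecutive levels, taken at
independent points `y` and `z`, is controlled by the Gagliardo seminorm. With `τ = 2^(-k)` the two
Jacobians cost `τ^(-2d)`, the kernel gains `τ^(d+2s)`, and integrating out `x` gains `τ^(d-1)`,
because `x` must lie within a multiple of `τ` of the contracted point. The total `τ^(2s-1)` is
summable after a square root exactly because `s > 1/2` (`lintegral_sq_sub_contr_le`). Telescoping
and Fatou's lemma give `sq_measure_mul_l2Sq_le`, and inserting `|U| ≥ c R^d` gives
`l2Sq_le_of_continuous` with the right powers of the diameter.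

Smooth functions are dense in `H^s(U)` (`exists_contDiff_close`): contracting `U` slightly into
itself leaves room for mollification. Hence traces exist by completeness of `L²(σ)`, and they
inherit the inequality (`exists_isTrace`, `IsTrace.l2Sq_le`).

No reference element is used. The mesh condition enters only through `|K| ≥ c h_K^d`; the ball bound
for surface measure on a facet has a constant depending on `d` alone, and `h_e ≤ h_K` turns `h_K⁻¹`
into `h_e⁻¹`. -/

theorem sq_eLpNorm_two {α : Type*} [MeasurableSpace α] (μ : Measure α) (f : α → ℝ) :
    eLpNorm f 2 μ ^ 2 = ∫⁻ x, ENNReal.ofReal (f x ^ 2) ∂μ := by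
  have h := eLpNorm_nnreal_pow_eq_lintegral (μ := μ) (f := f) (p := 2) (by norm_num)
  have h2 : ((2 : NNReal) : ℝ) = ((2 : ℕ) : ℝ) := by norm_num
  rw [h2, ENNReal.rpow_natCast] at h
  rw [show (2 : ℝ≥0∞) = ((2 : NNReal) : ℝ≥0∞) by norm_num, h]
  refine lintegral_congr fun x => ?_
  rw [ENNReal.rpow_natCast, Real.enorm_eq_ofReal_abs, ← ENNReal.ofReal_pow (abs_nonneg _), sq_abs]

theorem l2Sq_eq {d : ℕ} (μ : Measure (Euc d)) (w : Euc d → ℝ) : l2Sq μ w = eLpNorm w 2 μ ^ 2 :=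
  (sq_eLpNorm_two μ w).symm

/-- The difference quotient whose `L²` norm is the Gagliardo seminorm. -/
noncomputable def quot {d : ℕ} (s : ℝ) (w : Euc d → ℝ) (p : Euc d × Euc d) : ℝ :=
  (w p.1 - w p.2) / ‖p.1 - p.2‖ ^ (((d : ℝ) + 2 * s) / 2)

theorem quot_sq {d : ℕ} (s : ℝ) (w : Euc d → ℝ) (p : Euc d × Euc d) :
    quot s w p ^ 2 = (w p.1 - w p.2) ^ 2 / ‖p.1 - p.2‖ ^ ((d : ℝ) + 2 * s) := by
  rw [quot, div_pow, ← Real.rpow_mul_natCast (norm_nonneg _)]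
  norm_num

theorem gagliardoSq_eq {d : ℕ} (s : ℝ) (U : Set (Euc d)) (w : Euc d → ℝ) :
    gagliardoSq s U w =
      eLpNorm (quot s w) 2 ((volume.restrict U).prod (volume.restrict U)) ^ 2 := by
  rw [sq_eLpNorm_two, gagliardoSq]
  simp_rw [quot_sq]

theorem quot_sub {d : ℕ} (s : ℝ) (v w : Euc d → ℝ) : quot s (v - w) = quot s v - quot s w := by
  ext p
  simp only [quot, Pi.sub_apply]
  ring

theorem measurable_quot {d : ℕ} (s : ℝ) {w : Euc d → ℝ} (hw : Measurable w) :
    Measurable (quot s w) := by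
  unfold quot
  fun_prop

theorem sq_add_le_two_mul (a b : ℝ≥0∞) : (a + b) ^ 2 ≤ 2 * a ^ 2 + 2 * b ^ 2 := by
  have h := ENNReal.rpow_add_le_mul_rpow_add_rpow a b (p := 2) (by norm_num)
  norm_num at h
  rw [← mul_add]
  exact h

/-! ### Contractions towards a point -/

section Contraction

variable {E : Type*} [NormedAddCommGroup E] [NormedSpace ℝ E]

/-- The contraction with ratio `t` and centre `q`. -/
def contr (q : E) (t : ℝ) (p : E) : E := (1 - t) • q + t • p

theorem contr_one (q p : E) : contr q 1 p = p := by simp [contr]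

theorem contr_mem {U : Set E} (hU : Convex ℝ U) (ho : IsOpen U) {q p : E} (hq : q ∈ closure U)
    (hp : p ∈ U) {t : ℝ} (ht : 0 < t) (ht1 : t ≤ 1) : contr q t p ∈ U := by
  have := hU.combo_closure_interior_mem_interior hq (ho.interior_eq.symm ▸ hp)
    (a := 1 - t) (b := t) (by linarith) ht (by ring)
  rwa [ho.interior_eq] at this

theorem contr_sub_center (q p : E) (t : ℝ) : contr q t p - q = t • (p - q) := by
  simp only [contr]; module

theorem contr_sub_contr (q p p' : E) (t : ℝ) : contr q t p - contr q t p' = t • (p - p') := by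
  simp only [contr]; module

theorem contr_sub_self (q p : E) (t : ℝ) : contr q t p - p = (1 - t) • (q - p) := by
  simp only [contr]; module

theorem continuous_contr (q : E) (t : ℝ) : Continuous (contr q t) := by
  unfold contr; fun_prop

variable [MeasurableSpace E] [BorelSpace E] [FiniteDimensional ℝ E]

/-- A contraction centred in the closure keeps the open convex set inside itself, so the only loss
in the change of variables is the Jacobian. -/
theorem map_contr_le (μ : Measure E) [μ.IsAddHaarMeasure] {U : Set E} (hU : Convex ℝ U)
    (ho : IsOpen U) {q : E} (hq : q ∈ closure U) {t : ℝ} (ht : 0 < t) (ht1 : t ≤ 1) :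
    (μ.restrict U).map (contr q t) ≤
      ENNReal.ofReal ((t ^ Module.finrank ℝ E)⁻¹) • μ.restrict U := by
  refine Measure.le_iff.2 fun s hs => ?_
  have hm : Measurable (contr q t) := (continuous_contr q t).measurable
  rw [Measure.map_apply hm hs, Measure.restrict_apply (hm hs), Measure.smul_apply,
    Measure.restrict_apply hs, smul_eq_mul]
  calc μ (contr q t ⁻¹' s ∩ U) ≤ μ (contr q t ⁻¹' (s ∩ U)) :=
        measure_mono fun p hp => ⟨hp.1, contr_mem hU ho hq hp.2 ht ht1⟩
    _ = μ ((fun x => t • x) ⁻¹' ((fun y => (1 - t) • q + y) ⁻¹' (s ∩ U))) := rfl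
    _ = _ := by
        rw [Measure.addHaar_preimage_smul μ ht.ne', measure_preimage_add,
          abs_of_pos (by positivity)]

theorem lintegral_contr_le (μ : Measure E) [μ.IsAddHaarMeasure] {U : Set E} (hU : Convex ℝ U)
    (ho : IsOpen U) {q : E} (hq : q ∈ closure U) {t : ℝ} (ht : 0 < t) (ht1 : t ≤ 1)
    {f : E → ℝ≥0∞} (hf : Measurable f) :
    ∫⁻ p in U, f (contr q t p) ∂μ ≤
      ENNReal.ofReal ((t ^ Module.finrank ℝ E)⁻¹) * ∫⁻ p in U, f p ∂μ := by
  rw [← lintegral_map hf (continuous_contr q t).measurable, ← smul_eq_mul, ← lintegral_smul_measure]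
  exact lintegral_mono' (map_contr_le μ hU ho hq ht ht1) le_rfl

end Contraction

/-! ### Geometry of simplices -/

section Geometry

variable {d : ℕ}

theorem finrank_vectorSpan_facet (K : Affine.Simplex ℝ (Euc d) d) (i : Fin (d + 1)) (hd : 1 ≤ d) :
    Module.finrank ℝ (vectorSpan ℝ (K.points '' {j | j ≠ i})) = d - 1 := by
  classical
  have h := K.independent.finrank_vectorSpan_image_finset (s := Finset.univ.erase i) (n := d - 1)
    (by rw [Finset.card_erase_of_mem (Finset.mem_univ _), Finset.card_univ, Fintype.card_fin]; omega)
  have hs : K.points '' {j | j ≠ i} = ↑((Finset.univ.erase i).image K.points) := by ext; simp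
  rw [hs, h]

/-- A facet lies in the range of an isometric embedding of `ℝ^(d-1)`. -/
theorem exists_isometry_face_subset_range (K : Affine.Simplex ℝ (Euc d) d) (i : Fin (d + 1))
    (hd : 1 ≤ d) : ∃ f : Euc (d - 1) → Euc d, Isometry f ∧ face K i ⊆ Set.range f := by
  have : Nontrivial (Fin (d + 1)) := Fin.nontrivial_iff_two_le.2 (by omega)
  obtain ⟨j, hj⟩ := exists_ne i
  let V := vectorSpan ℝ (K.points '' {j | j ≠ i})
  let b : OrthonormalBasis (Fin (d - 1)) ℝ V :=
    (stdOrthonormalBasis ℝ V).reindex (finCongr (finrank_vectorSpan_facet K i hd))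
  refine ⟨fun z => (b.repr.symm z : Euc d) + K.points j, ?_, ?_⟩
  · refine Isometry.of_dist_eq fun x y => ?_
    rw [dist_add_right, ← Subtype.dist_eq, b.repr.symm.dist_map]
  · intro x hx
    have hx' : x ∈ affineSpan ℝ (K.points '' {j | j ≠ i}) := convexHull_subset_affineSpan _ hx
    have hp : K.points j ∈ affineSpan ℝ (K.points '' {j | j ≠ i}) :=
      subset_affineSpan _ _ ⟨j, hj, rfl⟩
    have hv : x -ᵥ K.points j ∈ V := by
      have := AffineSubspace.vsub_mem_direction hx' hp
      rwa [direction_affineSpan] at this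
    refine ⟨b.repr ⟨_, hv⟩, ?_⟩
    simp

/-- The constant in the bound of the surface measure of balls. -/
noncomputable def ballConst (d : ℕ) : ℝ :=
  2 ^ (d - 1) * (volume (Metric.ball (0 : Euc (d - 1)) 1)).toReal

theorem ballConst_nonneg (d : ℕ) : 0 ≤ ballConst d := by unfold ballConst; positivity

theorem isClosed_face (K : Affine.Simplex ℝ (Euc d) d) (i : Fin (d + 1)) : IsClosed (face K i) :=
  ((Set.toFinite _).isCompact_convexHull (𝕜 := ℝ)).isClosed

/-- A facet lies in an isometric copy of `ℝ^(d-1)`, where Hausdorff measure is Lebesgue measure. The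
bound therefore does not depend on the shape of the simplex. -/
theorem faceMeasure_closedBall_le (K : Affine.Simplex ℝ (Euc d) d) (i : Fin (d + 1))
    (hd : 1 ≤ d) (y : Euc d) {r : ℝ} (hr : 0 ≤ r) :
    faceMeasure K i (Metric.closedBall y r) ≤ ENNReal.ofReal (ballConst d * r ^ (d - 1)) := by
  obtain ⟨f, hf, hsub⟩ := exists_isometry_face_subset_range K i hd
  rw [faceMeasure, Measure.restrict_apply Metric.isClosed_closedBall.measurableSet]
  rcases (Metric.closedBall y r ∩ face K i).eq_empty_or_nonempty with h | ⟨a, ha, haf⟩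
  · simp [h]
  obtain ⟨z, rfl⟩ := hsub haf
  -- The centre `y` may lie off the facet; recentring at a point of the intersection doubles the
  -- radius, whence the `2 ^ (d - 1)` in `ballConst`.
  calc Measure.euclideanHausdorffMeasure (d - 1) (Metric.closedBall y r ∩ face K i)
      ≤ Measure.euclideanHausdorffMeasure (d - 1) (f '' Metric.closedBall z (2 * r)) := by
        refine measure_mono fun x hx => ?_
        obtain ⟨u, rfl⟩ := hsub hx.2
        refine ⟨u, ?_, rfl⟩
        rw [Metric.mem_closedBall, ← hf.dist_eq]
        have h1 := Metric.mem_closedBall.1 hx.1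
        have h2 := Metric.mem_closedBall'.1 ha
        linarith [dist_triangle (f u) y (f z)]
    _ = volume (Metric.closedBall z (2 * r)) := by
        rw [hf.euclideanHausdorffMeasure_image, EuclideanSpace.euclideanHausdorffMeasure_eq_volume]
    _ = ENNReal.ofReal (ballConst d * r ^ (d - 1)) := by
        rw [Measure.addHaar_closedBall _ _ (by positivity), finrank_euclideanSpace_fin, ballConst,
          mul_right_comm, ← mul_pow, ENNReal.ofReal_mul (by positivity),
          ENNReal.ofReal_toReal measure_ball_lt_top.ne]

/-! ### Topology and size of elements and facets. -/

theorem isCompact_body (K : Affine.Simplex ℝ (Euc d) d) : IsCompact (body K) :=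
  (Set.finite_range _).isCompact_convexHull (𝕜 := ℝ)

theorem convex_body (K : Affine.Simplex ℝ (Euc d) d) : Convex ℝ (body K) := convex_convexHull _ _

theorem isOpen_elem (K : Affine.Simplex ℝ (Euc d) d) : IsOpen (elem K) := isOpen_interior

theorem convex_elem (K : Affine.Simplex ℝ (Euc d) d) : Convex ℝ (elem K) := (convex_body K).interior

theorem elem_nonempty (K : Affine.Simplex ℝ (Euc d) d) : (elem K).Nonempty := by
  rw [elem, body, interior_convexHull_nonempty_iff_affineSpan_eq_top]
  exact K.independent.affineSpan_eq_top_iff_card_eq_finrank_add_one.2 (by simp)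

theorem isBounded_elem (K : Affine.Simplex ℝ (Euc d) d) : Bornology.IsBounded (elem K) :=
  (isCompact_body K).isBounded.subset interior_subset

theorem closure_elem (K : Affine.Simplex ℝ (Euc d) d) : closure (elem K) = body K := by
  rw [elem, (convex_body K).closure_interior_eq_closure_of_nonempty_interior (elem_nonempty K),
    (isCompact_body K).isClosed.closure_eq]

theorem face_subset_body (K : Affine.Simplex ℝ (Euc d) d) (i : Fin (d + 1)) :
    face K i ⊆ body K :=
  convexHull_mono (Set.image_subset_range _ _)

theorem faceDiam_le_elemDiam (K : Affine.Simplex ℝ (Euc d) d) (i : Fin (d + 1)) :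
    faceDiam K i ≤ elemDiam K :=
  Metric.diam_mono (face_subset_body K i) (isCompact_body K).isBounded

theorem faceDiam_pos (K : Affine.Simplex ℝ (Euc d) d) (i : Fin (d + 1)) (hd : 2 ≤ d) :
    0 < faceDiam K i := by
  obtain ⟨j, k, hj, hk, hjk⟩ : ∃ j k : Fin (d + 1), j ≠ i ∧ k ≠ i ∧ j ≠ k := by
    have : 2 < Fintype.card (Fin (d + 1)) := by simp; omega
    obtain ⟨a, b, c, hab, hac, hbc⟩ := Fintype.two_lt_card_iff.1 this
    by_cases ha : a = i
    · exact ⟨b, c, fun h => hab (ha.trans h.symm), fun h => hac (ha.trans h.symm), hbc⟩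
    · by_cases hb : b = i
      · exact ⟨a, c, ha, fun h => hbc (hb.trans h.symm), hac⟩
      · exact ⟨a, b, ha, hb, hab⟩
  refine Metric.diam_pos ⟨K.points j, subset_convexHull _ _ ⟨j, hj, rfl⟩, K.points k,
    subset_convexHull _ _ ⟨k, hk, rfl⟩, fun h => hjk (K.independent.injective h)⟩ ?_
  exact (isCompact_body K).isBounded.subset (face_subset_body K i)

theorem bddAbove_inscribed (K : Affine.Simplex ℝ (Euc d) d) (hd : 1 ≤ d) :
    BddAbove {r : ℝ | 0 ≤ r ∧ ∃ x, Metric.ball x r ⊆ body K} := by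
  have : Nonempty (Fin d) := ⟨⟨0, hd⟩⟩
  refine ⟨elemDiam K, ?_⟩
  rintro r ⟨hr, x, hx⟩
  have h := Metric.diam_mono hx (isCompact_body K).isBounded
  rw [Metric.diam_ball_eq x hr] at h
  exact le_trans (by linarith) h

/-- In a regular element there is a ball of radius comparable to the diameter. -/
theorem MeshRegular.exists_ball {ν : ℝ} {K : Affine.Simplex ℝ (Euc d) d} (hK : MeshRegular ν K)
    (hd : 2 ≤ d) {ν' : ℝ} (hν : ν ≤ ν') (hν' : 0 < ν') :
    ∃ x, Metric.ball x (elemDiam K / (4 * ν' ^ 2)) ⊆ elem K := by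
  let S := {r : ℝ | 0 ≤ r ∧ ∃ x, Metric.ball x r ⊆ body K}
  obtain ⟨x₀, hx₀⟩ := elem_nonempty K
  obtain ⟨r₀, hr₀, hb₀⟩ := Metric.isOpen_iff.1 (isOpen_elem K) x₀ hx₀
  have hr₀S : r₀ ∈ S := ⟨hr₀.le, x₀, hb₀.trans interior_subset⟩
  have hS : 0 < sSup S := hr₀.trans_le (le_csSup (bddAbove_inscribed K (by omega)) hr₀S)
  have hρ : inscribedDiam K = 2 * sSup S := rfl
  have hf := faceDiam_pos K 0 hd
  have hE : 0 < elemDiam K := hf.trans_le (faceDiam_le_elemDiam K 0)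
  have h := hK 0
  have h1 : faceDiam K 0 ≤ ν' * (2 * sSup S) := by
    have := ((le_max_left _ _).trans h).trans hν
    rwa [hρ, div_le_iff₀ (by positivity)] at this
  have h2 : elemDiam K ≤ ν' * faceDiam K 0 := by
    have := ((le_max_right _ _).trans h).trans hν
    rwa [div_le_iff₀ hf] at this
  -- The two mesh bounds give `h_K ≤ 2 ν'² sup r`. The factor 4 in place of 2 makes the inequality
  -- strict, so an actual ball exists whether or not the supremum is attained.
  have h3 : elemDiam K / (4 * ν' ^ 2) < sSup S := by
    rw [div_lt_iff₀ (by positivity)]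
    have : ν' * faceDiam K 0 ≤ ν' * (ν' * (2 * sSup S)) := by gcongr
    have h4 : 0 < ν' ^ 2 * sSup S := by positivity
    nlinarith
  obtain ⟨r, ⟨-, x, hx⟩, hr⟩ := exists_lt_of_lt_csSup ⟨r₀, hr₀S⟩ h3
  exact ⟨x, Metric.isOpen_ball.subset_interior_iff.2 ((Metric.ball_subset_ball hr.le).trans hx)⟩

instance isFiniteMeasure_faceMeasure [NeZero d] (K : Affine.Simplex ℝ (Euc d) d)
    (i : Fin (d + 1)) : IsFiniteMeasure (faceMeasure K i) := by
  obtain ⟨r, hr⟩ := ((isCompact_body K).isBounded.subset (face_subset_body K i)).subset_closedBall 0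
  have h := faceMeasure_closedBall_le K i (NeZero.one_le) 0 (le_max_right r 0)
  refine ⟨lt_of_le_of_lt ?_ (h.trans_lt ENNReal.ofReal_lt_top)⟩
  rw [faceMeasure, Measure.restrict_apply_univ, Measure.restrict_apply
    Metric.isClosed_closedBall.measurableSet]
  exact measure_mono fun x hx =>
    ⟨Metric.closedBall_subset_closedBall (le_max_left r 0) (hr hx), hx⟩

theorem ae_faceMeasure_mem_face (K : Affine.Simplex ℝ (Euc d) d) (i : Fin (d + 1)) :
    ∀ᵐ x ∂faceMeasure K i, x ∈ face K i :=
  ae_restrict_mem (isClosed_face K i).measurableSet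

end Geometry

/-! ### The trace inequality for continuous functions -/

section TraceInequality

variable {d : ℕ} {s : ℝ} {U : Set (Euc d)} {σ : Measure (Euc d)} {R M : ℝ}

theorem ofReal_sq_sub_le {φ : Euc d → ℝ} {α L : ℝ} (hα : 0 ≤ α) {a b : Euc d} (hL : ‖a - b‖ ≤ L) :
    ENNReal.ofReal ((φ a - φ b) ^ 2) ≤
      ENNReal.ofReal (L ^ α) * ENNReal.ofReal ((φ a - φ b) ^ 2 / ‖a - b‖ ^ α) := by
  rw [← ENNReal.ofReal_mul (Real.rpow_nonneg ((norm_nonneg _).trans hL) _)]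
  refine ENNReal.ofReal_le_ofReal ?_
  rcases eq_or_ne a b with rfl | hab
  · simp
  have hp : 0 < ‖a - b‖ := norm_pos_iff.2 (sub_ne_zero.2 hab)
  have hq : 0 < ‖a - b‖ ^ α := Real.rpow_pos_of_pos hp _
  rw [mul_div_assoc', le_div_iff₀ hq, mul_comm]
  gcongr

/-- Bookkeeping of the powers of `τ`: `-2d + (d + 2s) + (d - 1) = 2s - 1`. -/
theorem step_coefficient {τ : ℝ} (hd : 1 ≤ d) (hτ : 0 < τ) (hR : 0 ≤ R) :
    (τ ^ d)⁻¹ * ((τ / 2) ^ d)⁻¹ * (2 * (τ * R)) ^ ((d : ℝ) + 2 * s) * (M * (τ * R) ^ (d - 1)) =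
      τ ^ (2 * s - 1) * (2 ^ d * (2 * R) ^ ((d : ℝ) + 2 * s) * (M * R ^ (d - 1))) := by
  obtain ⟨n, rfl⟩ : ∃ n, d = n + 1 := ⟨d - 1, by omega⟩
  have h1 : (2 * (τ * R)) ^ (((n + 1 : ℕ) : ℝ) + 2 * s) =
      τ ^ (n + 1) * (τ ^ (2 * s - 1) * τ) * (2 * R) ^ (((n + 1 : ℕ) : ℝ) + 2 * s) := by
    rw [show 2 * (τ * R) = τ * (2 * R) by ring, Real.mul_rpow hτ.le (by positivity),
      Real.rpow_add hτ, Real.rpow_natCast, Real.rpow_sub_one hτ.ne', div_mul_cancel₀ _ hτ.ne']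
  rw [h1, Nat.add_sub_cancel, div_pow, mul_pow]
  field_simp
  ring

theorem lintegral_prod_contr_le (hU : Convex ℝ U) (ho : IsOpen U) {x : Euc d} (hx : x ∈ closure U)
    {τ τ' : ℝ} (hτ : 0 < τ) (hτ1 : τ ≤ 1) (hτ' : 0 < τ') (hτ1' : τ' ≤ 1)
    {J : Euc d × Euc d → ℝ≥0∞} (hJ : Measurable J) :
    ∫⁻ q, J (contr x τ q.1, contr x τ' q.2)
        ∂((volume.restrict U).prod (volume.restrict U)) ≤
      ENNReal.ofReal ((τ ^ d)⁻¹) * ENNReal.ofReal ((τ' ^ d)⁻¹) *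
        ∫⁻ q, J q ∂((volume.restrict U).prod (volume.restrict U)) := by
  have hc := (continuous_contr x τ).measurable
  have hc' := (continuous_contr x τ').measurable
  rw [lintegral_prod _ (by fun_prop), lintegral_prod _ hJ.aemeasurable]
  have h1 := fun a : Euc d => lintegral_contr_le volume hU ho hx hτ' hτ1'
    (f := fun b => J (a, b)) (by fun_prop)
  have h2 := lintegral_contr_le volume hU ho hx hτ hτ1
    (f := fun a => ∫⁻ b in U, J (a, b)) hJ.lintegral_prod_right'
  rw [finrank_euclideanSpace_fin] at h2
  simp only [finrank_euclideanSpace_fin] at h1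
  calc _ ≤ ∫⁻ a in U, ENNReal.ofReal ((τ' ^ d)⁻¹) * ∫⁻ b in U, J (contr x τ a, b) :=
        lintegral_mono fun a => h1 _
    _ = ENNReal.ofReal ((τ' ^ d)⁻¹) * ∫⁻ a in U, ∫⁻ b in U, J (contr x τ a, b) :=
        lintegral_const_mul' _ _ ENNReal.ofReal_ne_top
    _ ≤ _ := by
        rw [mul_comm (ENNReal.ofReal ((τ ^ d)⁻¹)), mul_assoc]
        gcongr

/-- One step of the telescoping. Both contracted points lie within `τ R` of `x`, hence within `2 τ
R` of each other, so inserting the kernel costs a bounded factor. Changing variables and integrating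
in `x` first then leaves the Gagliardo seminorm. -/
theorem lintegral_sq_sub_contr_le [IsFiniteMeasure σ] (hd : 1 ≤ d) (hs : 0 ≤ s) (hU : Convex ℝ U)
    (ho : IsOpen U) (hσ : ∀ᵐ x ∂σ, x ∈ closure U) (hR : 0 ≤ R)
    (hdist : ∀ x ∈ closure U, ∀ y ∈ closure U, dist x y ≤ R)
    (hM : ∀ y : Euc d, ∀ r : ℝ, 0 ≤ r →
      σ (Metric.closedBall y r) ≤ ENNReal.ofReal (M * r ^ (d - 1)))
    {φ : Euc d → ℝ} (hφ : Continuous φ) {τ : ℝ} (hτ : 0 < τ) (hτ1 : τ ≤ 1) :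
    ∫⁻ p : Euc d × Euc d × Euc d,
        ENNReal.ofReal ((φ (contr p.1 τ p.2.1) - φ (contr p.1 (τ / 2) p.2.2)) ^ 2)
        ∂(σ.prod ((volume.restrict U).prod (volume.restrict U))) ≤
      ENNReal.ofReal (τ ^ (2 * s - 1)) *
        (ENNReal.ofReal (2 ^ d * (2 * R) ^ ((d : ℝ) + 2 * s) * (M * R ^ (d - 1))) *
          gagliardoSq s U φ) := by
  set μ := volume.restrict U
  set α := (d : ℝ) + 2 * s
  have hα : 0 ≤ α := by positivity
  let F : Euc d × Euc d → ℝ≥0∞ := fun q =>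
    ENNReal.ofReal ((φ q.1 - φ q.2) ^ 2 / ‖q.1 - q.2‖ ^ α)
  have hφm := hφ.measurable
  have hF : Measurable F := by fun_prop
  -- The indicator of `B` records, through the change of variables, that the first contracted point
  -- is close to `x`. Without it the `x`-integral would not produce the decisive factor `τ^(d-1)`.
  let B : Set (Euc d × Euc d) := {z | dist z.1 z.2 ≤ τ * R}
  have hB : MeasurableSet B := (isClosed_le (by fun_prop) (by fun_prop)).measurableSet
  let J : Euc d → Euc d × Euc d → ℝ≥0∞ := fun x q => B.indicator 1 (q.1, x) * F q
  have hJ : Measurable (Function.uncurry J) := by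
    have h1 : Measurable (B.indicator (1 : Euc d × Euc d → ℝ≥0∞)) := measurable_one.indicator hB
    have h2 : Measurable fun z : Euc d × Euc d × Euc d =>
        B.indicator (1 : Euc d × Euc d → ℝ≥0∞) (z.2.1, z.1) :=
      h1.comp (measurable_snd.fst.prodMk measurable_fst)
    exact h2.mul (hF.comp measurable_snd)
  have hcont : ∀ t : ℝ, Continuous fun z : Euc d × Euc d => contr z.1 t z.2 := fun t => by
    unfold contr; fun_prop
  have hmeas : Measurable fun p : Euc d × Euc d × Euc d =>
      ENNReal.ofReal ((φ (contr p.1 τ p.2.1) - φ (contr p.1 (τ / 2) p.2.2)) ^ 2) := by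
    have e1 : Continuous fun p : Euc d × Euc d × Euc d => contr p.1 τ p.2.1 :=
      (hcont τ).comp (by fun_prop : Continuous fun p : Euc d × Euc d × Euc d => (p.1, p.2.1))
    have e2 : Continuous fun p : Euc d × Euc d × Euc d => contr p.1 (τ / 2) p.2.2 :=
      (hcont (τ / 2)).comp (by fun_prop : Continuous fun p : Euc d × Euc d × Euc d => (p.1, p.2.2))
    have : Continuous fun p : Euc d × Euc d × Euc d =>
      (φ (contr p.1 τ p.2.1) - φ (contr p.1 (τ / 2) p.2.2)) ^ 2 := by fun_prop
    exact this.measurable.ennreal_ofReal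
  have hmem : ∀ᵐ q ∂(μ.prod μ), q.1 ∈ U ∧ q.2 ∈ U := by
    rw [Measure.prod_restrict]
    exact ae_restrict_mem (ho.measurableSet.prod ho.measurableSet)
  set c := ENNReal.ofReal ((τ ^ d)⁻¹) * ENNReal.ofReal (((τ / 2) ^ d)⁻¹)
  set L := ENNReal.ofReal ((2 * (τ * R)) ^ α)
  have hinner : ∀ᵐ x ∂σ, ∫⁻ q, ENNReal.ofReal
      ((φ (contr x τ q.1) - φ (contr x (τ / 2) q.2)) ^ 2) ∂(μ.prod μ) ≤
      L * (c * ∫⁻ q, J x q ∂(μ.prod μ)) := by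
    filter_upwards [hσ] with x hx
    calc _ ≤ ∫⁻ q, L * J x (contr x τ q.1, contr x (τ / 2) q.2) ∂(μ.prod μ) := by
          refine lintegral_mono_ae ?_
          filter_upwards [hmem] with q hq
          have hd1 : ∀ t : ℝ, 0 < t → ∀ y ∈ U, ‖contr x t y - x‖ ≤ t * R := fun t ht y hy => by
            rw [contr_sub_center, norm_smul, Real.norm_of_nonneg ht.le, ← dist_eq_norm]
            gcongr
            exact hdist _ (subset_closure hy) _ hx
          have h1 := hd1 τ hτ _ hq.1
          have h2 := hd1 (τ / 2) (by positivity) _ hq.2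
          have h3 : ‖contr x τ q.1 - contr x (τ / 2) q.2‖ ≤ 2 * (τ * R) := by
            have := norm_sub_le (contr x τ q.1 - x) (contr x (τ / 2) q.2 - x)
            rw [sub_sub_sub_cancel_right] at this
            have : 0 ≤ τ * R := by positivity
            linarith
          have hBm : (contr x τ q.1, x) ∈ B := by
            simpa [B, dist_eq_norm] using h1
          simp only [J, Set.indicator_of_mem hBm, Pi.one_apply, one_mul]
          exact ofReal_sq_sub_le hα h3
      _ = L * ∫⁻ q, J x (contr x τ q.1, contr x (τ / 2) q.2) ∂(μ.prod μ) :=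
          lintegral_const_mul' _ _ ENNReal.ofReal_ne_top
      _ ≤ _ := by
          have hJx : Measurable (J x) := hJ.of_uncurry_left
          exact mul_le_mul_right (lintegral_prod_contr_le (τ' := τ / 2) hU ho hx hτ hτ1
            (half_pos hτ) (by linarith) hJx) L
  have hcne : c ≠ ⊤ := ENNReal.mul_ne_top ENNReal.ofReal_ne_top ENNReal.ofReal_ne_top
  rw [lintegral_prod _ hmeas.aemeasurable]
  calc _ ≤ ∫⁻ x, L * (c * ∫⁻ q, J x q ∂(μ.prod μ)) ∂σ := lintegral_mono_ae hinner
    _ = L * (c * ∫⁻ x, ∫⁻ q, J x q ∂(μ.prod μ) ∂σ) := by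
        rw [lintegral_const_mul' _ _ ENNReal.ofReal_ne_top, lintegral_const_mul' _ _ hcne]
    _ = L * (c * ∫⁻ q, ∫⁻ x, J x q ∂σ ∂(μ.prod μ)) := by
        rw [lintegral_lintegral_swap hJ.aemeasurable]
    -- After the exchange of integrals, `x` occurs only in the indicator, so its integral is the
    -- `σ`-measure of a ball.
    _ ≤ L * (c * ∫⁻ q, ENNReal.ofReal (M * (τ * R) ^ (d - 1)) * F q ∂(μ.prod μ)) := by
        gcongr with q
        have hset : ∀ x, B.indicator (1 : Euc d × Euc d → ℝ≥0∞) (q.1, x) =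
            (Metric.closedBall q.1 (τ * R)).indicator 1 x := fun x => by
          by_cases h : dist q.1 x ≤ τ * R
          · rw [Set.indicator_of_mem (show (q.1, x) ∈ B from h),
              Set.indicator_of_mem (Metric.mem_closedBall'.2 h)]
            rfl
          · rw [Set.indicator_of_notMem (show (q.1, x) ∉ B from h),
              Set.indicator_of_notMem (fun h' => h (Metric.mem_closedBall'.1 h'))]
        simp only [J, hset]
        rw [lintegral_mul_const _ (measurable_one.indicator Metric.isClosed_closedBall.measurableSet),
          lintegral_indicator_one Metric.isClosed_closedBall.measurableSet]
        gcongr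
        exact hM _ _ (by positivity)
    _ = L * (c * (ENNReal.ofReal (M * (τ * R) ^ (d - 1)) * gagliardoSq s U φ)) := by
        rw [lintegral_const_mul' _ _ ENNReal.ofReal_ne_top]; rfl
    _ = _ := by
        rw [← mul_assoc (ENNReal.ofReal (τ ^ (2 * s - 1))), ← ENNReal.ofReal_mul (by positivity),
          ← step_coefficient (s := s) (M := M) (R := R) hd hτ hR,
          ENNReal.ofReal_mul
            (p := (τ ^ d)⁻¹ * ((τ / 2) ^ d)⁻¹ * (2 * (τ * R)) ^ ((d : ℝ) + 2 * s)) (by positivity),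
          ENNReal.ofReal_mul (p := (τ ^ d)⁻¹ * ((τ / 2) ^ d)⁻¹) (by positivity),
          ENNReal.ofReal_mul (p := (τ ^ d)⁻¹) (by positivity)]
        simp only [c, L, α]
        ring

/-- The triangle inequality after exchanging the two independent copies of `U`, which preserves the
product measure and lets the next level be read at the second point. -/
theorem eLpNorm_contr_half_le [IsFiniteMeasure σ] (hUb : Bornology.IsBounded U)
    {φ : Euc d → ℝ} (hφ : Continuous φ) (τ : ℝ) :
    eLpNorm (fun p : Euc d × Euc d × Euc d => φ (contr p.1 (τ / 2) p.2.1)) 2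
        (σ.prod ((volume.restrict U).prod (volume.restrict U))) ≤
      eLpNorm (fun p : Euc d × Euc d × Euc d => φ (contr p.1 τ p.2.1)) 2
        (σ.prod ((volume.restrict U).prod (volume.restrict U))) +
      eLpNorm (fun p : Euc d × Euc d × Euc d =>
          φ (contr p.1 τ p.2.1) - φ (contr p.1 (τ / 2) p.2.2)) 2
        (σ.prod ((volume.restrict U).prod (volume.restrict U))) := by
  have : IsFiniteMeasure (volume.restrict U) := isFiniteMeasure_restrict.2 hUb.measure_lt_top.ne
  have hswap : MeasurePreserving (Prod.map id Prod.swap)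
      (σ.prod ((volume.restrict U).prod (volume.restrict U)))
      (σ.prod ((volume.restrict U).prod (volume.restrict U))) :=
    (MeasurePreserving.id σ).prod Measure.measurePreserving_swap
  have hc1 : ∀ t : ℝ, Continuous fun p : Euc d × Euc d × Euc d => φ (contr p.1 t p.2.1) :=
    fun t => hφ.comp (by unfold contr; fun_prop)
  have hc2 : ∀ t : ℝ, Continuous fun p : Euc d × Euc d × Euc d => φ (contr p.1 t p.2.2) :=
    fun t => hφ.comp (by unfold contr; fun_prop)
  rw [← eLpNorm_comp_measurePreserving (hc1 (τ / 2)).aestronglyMeasurable hswap]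
  refine le_trans (le_of_eq ?_) (eLpNorm_sub_le (hc1 τ).aestronglyMeasurable
    ((hc1 τ).sub (hc2 (τ / 2))).aestronglyMeasurable one_le_two)
  congr 1
  ext p
  simp

theorem tendsto_contr_half_pow (x y : Euc d) :
    Tendsto (fun k : ℕ => contr x ((1 / 2 : ℝ) ^ k) y) atTop (𝓝 x) := by
  have h : Tendsto (fun k : ℕ => (1 / 2 : ℝ) ^ k) atTop (𝓝 0) :=
    tendsto_pow_atTop_nhds_zero_of_lt_one (by norm_num) (by norm_num)
  have := ((h.const_sub 1).smul_const x).add (h.smul_const y)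
  simpa [contr] using this

/-- The contribution of the Gagliardo seminorm to the trace inequality. -/
noncomputable def stepConst (d : ℕ) (s R M : ℝ) : ℝ :=
  2 ^ d * (2 * R) ^ ((d : ℝ) + 2 * s) * (M * R ^ (d - 1))

/-- The ratio of consecutive steps in the telescoping argument. -/
noncomputable def stepRatio (s : ℝ) : ℝ := (1 / 2 : ℝ) ^ (s - 1 / 2)

theorem stepRatio_pos (s : ℝ) : 0 < stepRatio s := Real.rpow_pos_of_pos (by norm_num) _

theorem stepRatio_lt_one (hs : 1 / 2 < s) : stepRatio s < 1 :=
  Real.rpow_lt_one (by norm_num) (by norm_num) (by linarith)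

theorem stepRatio_pow_sq (k : ℕ) :
    ((1 / 2 : ℝ) ^ k) ^ (2 * s - 1) = (stepRatio s ^ k) ^ 2 := by
  rw [stepRatio, ← Real.rpow_natCast, ← Real.rpow_natCast, ← Real.rpow_natCast,
    ← Real.rpow_mul (by norm_num), ← Real.rpow_mul (by positivity), ← Real.rpow_mul (by positivity)]
  congr 1
  push_cast
  ring

/-- Everything is integrated over `σ × U × U`, so a function of the boundary point alone acquires
the factor `|U|²`. The levels increase by at most a geometric series of ratio `stepRatio s < 1`. -/
theorem sq_measure_mul_l2Sq_le [IsFiniteMeasure σ] (hd : 1 ≤ d) (hs : 1 / 2 < s)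
    (hU : Convex ℝ U) (ho : IsOpen U) (hUb : Bornology.IsBounded U)
    (hσ : ∀ᵐ x ∂σ, x ∈ closure U) (hR : 0 ≤ R)
    (hdist : ∀ x ∈ closure U, ∀ y ∈ closure U, dist x y ≤ R)
    (hM : ∀ y : Euc d, ∀ r : ℝ, 0 ≤ r →
      σ (Metric.closedBall y r) ≤ ENNReal.ofReal (M * r ^ (d - 1)))
    {φ : Euc d → ℝ} (hφ : Continuous φ) :
    volume U ^ 2 * l2Sq σ φ ≤
      2 * (σ Set.univ * volume U * l2Sq (volume.restrict U) φ) +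
      2 * (ENNReal.ofReal ((1 - stepRatio s)⁻¹ ^ 2 * stepConst d s R M) * gagliardoSq s U φ) := by
  have : IsFiniteMeasure (volume.restrict U) := isFiniteMeasure_restrict.2 hUb.measure_lt_top.ne
  set μ := volume.restrict U
  set P := σ.prod (μ.prod μ)
  have hμ : μ Set.univ = volume U := by simp [μ]
  set ρ := ENNReal.ofReal (stepRatio s)
  let f : ℕ → Euc d × Euc d × Euc d → ℝ := fun k p => φ (contr p.1 ((1 / 2 : ℝ) ^ k) p.2.1)
  have hf : ∀ k, Continuous (f k) := fun k => hφ.comp (by unfold contr; fun_prop)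
  set Q := ENNReal.ofReal (stepConst d s R M) * gagliardoSq s U φ
  -- The square root of the one-step bound, since the telescoping adds norms rather than their
  -- squares.
  set q := Q ^ (1 / 2 : ℝ)
  have hq : q ^ 2 = Q := by
    rw [← ENNReal.rpow_natCast, ← ENNReal.rpow_mul]; norm_num
  have hstep : ∀ k, eLpNorm (f (k + 1)) 2 P ≤ eLpNorm (f k) 2 P + ρ ^ k * q := fun k => by
    have h1 := eLpNorm_contr_half_le (σ := σ) hUb hφ ((1 / 2 : ℝ) ^ k)
    have h2 := lintegral_sq_sub_contr_le (s := s) hd (by linarith) hU ho hσ hR hdist hM hφ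
      (τ := (1 / 2 : ℝ) ^ k) (by positivity) (pow_le_one₀ (by norm_num) (by norm_num))
    rw [← sq_eLpNorm_two, stepRatio_pow_sq, ENNReal.ofReal_pow (pow_nonneg (stepRatio_pos s).le k),
      ENNReal.ofReal_pow (stepRatio_pos s).le] at h2
    change _ ≤ (ρ ^ k) ^ 2 * Q at h2
    rw [← hq, ← mul_pow, ENNReal.pow_le_pow_left_iff two_ne_zero] at h2
    rw [show (1 / 2 : ℝ) ^ k / 2 = (1 / 2 : ℝ) ^ (k + 1) by ring] at h1 h2
    exact h1.trans (by gcongr)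
  have hsum : ∀ n, eLpNorm (f n) 2 P ≤ eLpNorm (f 0) 2 P + ∑ k ∈ Finset.range n, ρ ^ k * q := by
    intro n
    induction n with
    | zero => simp
    | succ n ih =>
      rw [Finset.sum_range_succ, ← add_assoc]
      exact (hstep n).trans (by gcongr)
  have hbound : ∀ n, eLpNorm (f n) 2 P ≤ eLpNorm (f 0) 2 P + (1 - ρ)⁻¹ * q := fun n => by
    refine (hsum n).trans ?_
    rw [← Finset.sum_mul, ← ENNReal.tsum_geometric]
    gcongr
    exact ENNReal.sum_le_tsum _
  have hconst : ∀ g : Euc d → ℝ≥0∞, Measurable g →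
      ∫⁻ p : Euc d × Euc d × Euc d, g p.1 ∂P = (∫⁻ x, g x ∂σ) * volume U ^ 2 := fun g hg => by
    rw [lintegral_prod _ (by fun_prop)]
    simp only [lintegral_const, ← Set.univ_prod_univ, Measure.prod_prod, hμ]
    rw [lintegral_mul_const _ hg, sq]
  have hzero : eLpNorm (f 0) 2 P ^ 2 = σ Set.univ * volume U * l2Sq μ φ := by
    have hφm := hφ.measurable
    rw [sq_eLpNorm_two, lintegral_prod _ (by have := (hf 0).measurable; fun_prop)]
    simp only [f, pow_zero, contr_one, lintegral_const]
    rw [lintegral_prod _ (by fun_prop)]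
    simp only [lintegral_const, hμ]
    rw [lintegral_mul_const _ (by fun_prop), l2Sq]
    ring
  -- Fatou's lemma: the levels converge pointwise to the boundary value by continuity of `φ`, and
  -- their norms are uniformly bounded.
  have hlim : volume U ^ 2 * l2Sq σ φ ≤ (eLpNorm (f 0) 2 P + (1 - ρ)⁻¹ * q) ^ 2 := by
    have hφm := hφ.measurable
    rw [mul_comm, l2Sq, ← hconst (fun x => ENNReal.ofReal (φ x ^ 2)) (by fun_prop)]
    calc ∫⁻ p : Euc d × Euc d × Euc d, ENNReal.ofReal (φ p.1 ^ 2) ∂P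
        = ∫⁻ p, liminf (fun k => ENNReal.ofReal (f k p ^ 2)) atTop ∂P := by
          refine lintegral_congr fun p => (Tendsto.liminf_eq ?_).symm
          exact ENNReal.tendsto_ofReal
            (((hφ.tendsto _).comp (tendsto_contr_half_pow p.1 p.2.1)).pow 2)
      _ ≤ liminf (fun k => ∫⁻ p, ENNReal.ofReal (f k p ^ 2) ∂P) atTop :=
          lintegral_liminf_le fun k => by have := (hf k).measurable; fun_prop
      _ ≤ _ := by
          refine liminf_le_of_le (by isBoundedDefault) fun b hb => ?_
          obtain ⟨k, hk⟩ := hb.exists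
          refine hk.trans ?_
          rw [← sq_eLpNorm_two]
          gcongr
          exact hbound k
  refine hlim.trans ((sq_add_le_two_mul _ _).trans (le_of_eq ?_))
  have hρ : (1 - ρ)⁻¹ = ENNReal.ofReal ((1 - stepRatio s)⁻¹) := by
    rw [ENNReal.ofReal_inv_of_pos (by linarith [stepRatio_lt_one hs]),
      ENNReal.ofReal_sub _ (stepRatio_pos s).le, ENNReal.ofReal_one]
  have h0 : 0 ≤ (1 - stepRatio s)⁻¹ := inv_nonneg.2 (by linarith [stepRatio_lt_one hs])
  rw [hzero, mul_pow, hq, hρ, ENNReal.ofReal_mul (by positivity), ENNReal.ofReal_pow h0]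
  simp only [Q, mul_assoc]

/-- The constant in the trace inequality on a domain whose volume is at least `c R ^ d`. -/
noncomputable def traceConst (d : ℕ) (s c M : ℝ) : ℝ :=
  2 * M / c + 2 * ((1 - stepRatio s)⁻¹ ^ 2 * stepConst d s 1 M) / c ^ 2

/-- Isolates the scaling: dividing by `|U|²`, which is at least of order `(R^d)²`, leaves `R⁻¹
R^(2s)`. -/
theorem stepConst_eq (hR : 0 < R) (hd : 1 ≤ d) :
    stepConst d s R M = stepConst d s 1 M * (R ^ d) ^ 2 * R⁻¹ * R ^ (2 * s) := by
  obtain ⟨n, rfl⟩ : ∃ n, d = n + 1 := ⟨d - 1, by omega⟩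
  rw [stepConst, stepConst, Real.mul_rpow zero_le_two hR.le, mul_one, Real.rpow_add hR,
    Real.rpow_natCast, Nat.add_sub_cancel, one_pow]
  field_simp
  ring

/-- The trace inequality for continuous functions. -/
theorem l2Sq_le_of_continuous [IsFiniteMeasure σ] (hd : 1 ≤ d) (hs : 1 / 2 < s)
    (hU : Convex ℝ U) (ho : IsOpen U) (hUb : Bornology.IsBounded U)
    (hσ : ∀ᵐ x ∂σ, x ∈ closure U) (hR : 0 < R)
    (hdist : ∀ x ∈ closure U, ∀ y ∈ closure U, dist x y ≤ R) (hM0 : 0 ≤ M)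
    (hM : ∀ y : Euc d, ∀ r : ℝ, 0 ≤ r →
      σ (Metric.closedBall y r) ≤ ENNReal.ofReal (M * r ^ (d - 1)))
    {c : ℝ} (hc : 0 < c) (hvol : ENNReal.ofReal (c * R ^ d) ≤ volume U)
    {φ : Euc d → ℝ} (hφ : Continuous φ) :
    l2Sq σ φ ≤ ENNReal.ofReal (traceConst d s c M * R⁻¹) *
      (l2Sq (volume.restrict U) φ + ENNReal.ofReal (R ^ (2 * s)) * gagliardoSq s U φ) := by
  have hpos : volume U ≠ 0 :=
    (lt_of_lt_of_le (ENNReal.ofReal_pos.2 (by positivity)) hvol).ne'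
  have hne : U.Nonempty := nonempty_of_measure_ne_zero hpos
  have hρ := stepRatio_lt_one hs
  have hA0 : 0 ≤ stepConst d s 1 M := by unfold stepConst; positivity
  set A := (1 - stepRatio s)⁻¹ ^ 2 * stepConst d s 1 M with hA
  have hA' : 0 ≤ A := by positivity
  have hσuniv : σ Set.univ ≤ ENNReal.ofReal (M * R ^ (d - 1)) := by
    obtain ⟨y, hy⟩ := hne
    refine le_trans (measure_mono_ae ?_) (hM y R hR.le)
    filter_upwards [hσ] with x hx _
    exact hdist x hx y (subset_closure hy)
  have hV1 : 2 * σ Set.univ ≤ volume U * ENNReal.ofReal (2 * M / c * R⁻¹) := by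
    calc 2 * σ Set.univ ≤ ENNReal.ofReal 2 * ENNReal.ofReal (M * R ^ (d - 1)) := by
          rw [ENNReal.ofReal_ofNat]; gcongr
      _ = ENNReal.ofReal (c * R ^ d) * ENNReal.ofReal (2 * M / c * R⁻¹) := by
          rw [← ENNReal.ofReal_mul (by positivity), ← ENNReal.ofReal_mul (by positivity)]
          congr 1
          obtain ⟨n, rfl⟩ : ∃ n, d = n + 1 := ⟨d - 1, by omega⟩
          rw [Nat.add_sub_cancel]
          field_simp
          ring
      _ ≤ _ := by gcongr
  have hV2 : 2 * ENNReal.ofReal ((1 - stepRatio s)⁻¹ ^ 2 * stepConst d s R M) ≤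
      volume U ^ 2 * (ENNReal.ofReal (2 * A / c ^ 2 * R⁻¹) * ENNReal.ofReal (R ^ (2 * s))) := by
    calc _ = ENNReal.ofReal (c * R ^ d) ^ 2 *
          (ENNReal.ofReal (2 * A / c ^ 2 * R⁻¹) * ENNReal.ofReal (R ^ (2 * s))) := by
          rw [← ENNReal.ofReal_ofNat, ← ENNReal.ofReal_mul (by positivity),
            ← ENNReal.ofReal_mul (by positivity), ← ENNReal.ofReal_pow (by positivity),
            ← ENNReal.ofReal_mul (by positivity)]
          congr 1
          rw [stepConst_eq hR hd, hA]
          field_simp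
      _ ≤ _ := by gcongr
  have hC1 : ENNReal.ofReal (2 * M / c * R⁻¹) ≤ ENNReal.ofReal (traceConst d s c M * R⁻¹) := by
    refine ENNReal.ofReal_le_ofReal (mul_le_mul_of_nonneg_right ?_ (by positivity))
    exact le_add_of_nonneg_right (by positivity)
  have hC2 : ENNReal.ofReal (2 * A / c ^ 2 * R⁻¹) ≤ ENNReal.ofReal (traceConst d s c M * R⁻¹) := by
    refine ENNReal.ofReal_le_ofReal (mul_le_mul_of_nonneg_right ?_ (by positivity))
    exact le_add_of_nonneg_left (by positivity)
  -- The factor `|U|²` can be cancelled because it is neither zero nor infinite.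
  refine (ENNReal.mul_le_mul_iff_right (pow_ne_zero 2 hpos)
    (ENNReal.pow_ne_top hUb.measure_lt_top.ne)).1 ?_
  calc _ ≤ _ := sq_measure_mul_l2Sq_le hd hs hU ho hUb hσ hR.le hdist hM hφ
    _ = 2 * σ Set.univ * (volume U * l2Sq (volume.restrict U) φ) +
        2 * ENNReal.ofReal ((1 - stepRatio s)⁻¹ ^ 2 * stepConst d s R M) * gagliardoSq s U φ := by
        ring
    _ ≤ volume U * ENNReal.ofReal (traceConst d s c M * R⁻¹) *
          (volume U * l2Sq (volume.restrict U) φ) +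
        volume U ^ 2 * (ENNReal.ofReal (traceConst d s c M * R⁻¹) *
          ENNReal.ofReal (R ^ (2 * s))) * gagliardoSq s U φ := by
        refine add_le_add (mul_le_mul_left (hV1.trans ?_) _) (mul_le_mul_left (hV2.trans ?_) _)
        · exact mul_le_mul_right hC1 _
        · exact mul_le_mul_right (mul_le_mul_left hC2 _) _
    _ = _ := by ring

end TraceInequality

/-! ### Averages of functions in `L²` -/

/-- Minkowski's inequality for averages. -/
theorem eLpNorm_two_average_le {X Y : Type*} [MeasurableSpace X] [MeasurableSpace Y]
    {m : Measure X} [SFinite m] {ν : Measure Y} [IsProbabilityMeasure ν] {g : Y → X → ℝ}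
    (hg : Measurable (Function.uncurry g)) {ε : ℝ≥0∞} (h : ∀ᵐ u ∂ν, eLpNorm (g u) 2 m ≤ ε) :
    eLpNorm (fun p => ∫ u, g u p ∂ν) 2 m ≤ ε := by
  rw [← ENNReal.pow_le_pow_left_iff two_ne_zero, sq_eLpNorm_two]
  calc ∫⁻ p, ENNReal.ofReal ((∫ u, g u p ∂ν) ^ 2) ∂m
      ≤ ∫⁻ p, ∫⁻ u, ENNReal.ofReal (g u p ^ 2) ∂ν ∂m := by
        refine lintegral_mono fun p => ?_
        have hgp : Measurable fun u => g u p := hg.comp measurable_prodMk_right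
        rw [← sq_eLpNorm_two ν fun u => g u p, ← sq_abs, ENNReal.ofReal_pow (abs_nonneg _),
          ← Real.enorm_eq_ofReal_abs]
        gcongr
        calc ‖∫ u, g u p ∂ν‖ₑ ≤ ∫⁻ u, ‖g u p‖ₑ ∂ν := enorm_integral_le_lintegral_enorm _
          _ = eLpNorm (fun u => g u p) 1 ν := eLpNorm_one_eq_lintegral_enorm.symm
          _ ≤ eLpNorm (fun u => g u p) 2 ν :=
            eLpNorm_le_eLpNorm_of_exponent_le one_le_two hgp.aestronglyMeasurable
    _ = ∫⁻ u, ∫⁻ p, ENNReal.ofReal (g u p ^ 2) ∂m ∂ν := by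
        refine (lintegral_lintegral_swap (f := fun u p => ENNReal.ofReal (g u p ^ 2)) ?_).symm
        exact (hg.pow_const 2).ennreal_ofReal.aemeasurable
    _ ≤ ∫⁻ _, ε ^ 2 ∂ν := by
        refine lintegral_mono_ae ?_
        filter_upwards [h] with u hu
        rw [← sq_eLpNorm_two]
        gcongr
    _ = ε ^ 2 := by simp

/-! ### Continuity of contractions in `L²` -/

section Contraction

variable {E : Type*} [NormedAddCommGroup E] [NormedSpace ℝ E] [MeasurableSpace E] [BorelSpace E]
  [FiniteDimensional ℝ E]

theorem eLpNorm_comp_contr_le (μ : Measure E) [μ.IsAddHaarMeasure] {U : Set E} (hU : Convex ℝ U)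
    (ho : IsOpen U) {q : E} (hq : q ∈ closure U) {t : ℝ} (ht : 1 / 2 ≤ t) (ht1 : t ≤ 1)
    {h : E → ℝ} (hh : AEStronglyMeasurable h (μ.restrict U)) :
    eLpNorm (h ∘ contr q t) 2 (μ.restrict U) ≤
      ENNReal.ofReal (2 ^ Module.finrank ℝ E) ^ (1 / 2 : ℝ) * eLpNorm h 2 (μ.restrict U) := by
  have ht0 : 0 < t := by linarith
  have hle := map_contr_le μ hU ho hq ht0 ht1
  have hac : (μ.restrict U).map (contr q t) ≪ μ.restrict U :=
    Measure.absolutelyContinuous_of_le_smul hle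
  rw [← eLpNorm_map_measure (hh.mono_ac hac) (continuous_contr q t).measurable.aemeasurable]
  refine (eLpNorm_mono_measure h hle).trans ?_
  rw [eLpNorm_smul_measure_of_ne_top ENNReal.ofNat_ne_top, smul_eq_mul, ENNReal.toReal_div]
  simp only [ENNReal.toReal_one, ENNReal.toReal_ofNat]
  gcongr
  rw [← inv_pow]
  gcongr
  rw [inv_le_comm₀ ht0 two_pos]
  linarith

/-- True for a uniformly continuous function, because points of `U` move by at most `t` times the
diameter; in general by approximation in `L²`, contractions of ratio at least `1/2` being uniformly
bounded there. Uniformity in the centre `q` is what allows averaging over centres later. -/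
theorem exists_eLpNorm_contr_sub_le (μ : Measure E) [μ.IsAddHaarMeasure] {U : Set E}
    (hU : Convex ℝ U) (ho : IsOpen U) (hUb : Bornology.IsBounded U) {F : E → ℝ}
    (hF : MemLp F 2 (μ.restrict U)) {ε : ℝ≥0∞} (hε : ε ≠ 0) :
    ∃ δ : ℝ, 0 < δ ∧ ∀ t : ℝ, 0 < t → t ≤ 1 / 2 → t ≤ δ → ∀ q ∈ U,
      eLpNorm (fun p => F (contr q (1 - t) p) - F p) 2 (μ.restrict U) ≤ ε := by
  have hμ : μ U ≠ ⊤ := hUb.measure_lt_top.ne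
  have : IsFiniteMeasure (μ.restrict U) := isFiniteMeasure_restrict.2 hμ
  set c := ENNReal.ofReal (2 ^ Module.finrank ℝ E) ^ (1 / 2 : ℝ)
  have hc : c ≠ ⊤ := ENNReal.rpow_ne_top_of_nonneg (by norm_num) ENNReal.ofReal_ne_top
  have hε2 : ε / 2 ≠ 0 := (ENNReal.half_pos hε).ne'
  -- The error `F - G` is counted twice, once composed with the contraction (factor `c`) and once
  -- plain.
  obtain ⟨ε₁, hε₁, hcε⟩ := ENNReal.exists_nnreal_pos_mul_lt (a := c + 1) (by finiteness) hε2
  obtain ⟨G, hGs, hFG, hGc, hG⟩ := hF.exists_hasCompactSupport_eLpNorm_sub_le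
    ENNReal.ofNat_ne_top (ε := ε₁) (by simpa using hε₁.ne')
  have hne : (μ.restrict U) Set.univ ^ (2 : ℝ≥0∞).toReal⁻¹ ≠ ⊤ :=
    ENNReal.rpow_ne_top_of_nonneg (by norm_num) (measure_ne_top _ _)
  obtain ⟨η, hη, hηε⟩ := ENNReal.exists_nnreal_pos_mul_lt hne hε2
  obtain ⟨δ, hδ, hGδ⟩ := Metric.uniformContinuous_iff.1
    (hGs.uniformContinuous_of_continuous hGc) η hη
  obtain ⟨D, hD⟩ := Metric.isBounded_iff.1 hUb
  refine ⟨δ / (2 * (|D| + 1)), by positivity, fun t ht ht2 htδ q hq => ?_⟩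
  have hD' : t * |D| < δ := by
    rw [le_div_iff₀ (by positivity)] at htδ
    nlinarith [abs_nonneg D]
  have hTm := continuous_contr q (1 - t)
  have h1 : eLpNorm (fun p => G (contr q (1 - t) p) - G p) 2 (μ.restrict U) ≤ ε / 2 := by
    refine (eLpNorm_le_of_ae_bound (C := η) ?_).trans ?_
    · filter_upwards [ae_restrict_mem ho.measurableSet] with p hp
      rw [← dist_eq_norm]
      refine (hGδ ?_).le
      rw [dist_eq_norm, contr_sub_self, norm_smul, sub_sub_cancel, Real.norm_of_nonneg ht.le,
        ← dist_eq_norm]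
      refine lt_of_le_of_lt ?_ hD'
      gcongr
      exact (hD hq hp).trans (le_abs_self D)
    · rw [ENNReal.ofReal_coe_nnreal, mul_comm]
      exact hηε.le
  have hFGm := (hF.sub hG).aestronglyMeasurable
  have h2 := eLpNorm_comp_contr_le μ hU ho (subset_closure hq) (t := 1 - t) (by linarith)
    (by linarith) hFGm
  have hm2 : AEStronglyMeasurable ((F - G) ∘ contr q (1 - t)) (μ.restrict U) :=
    (hFGm.mono_ac (Measure.absolutelyContinuous_of_le_smul (map_contr_le μ hU ho
      (subset_closure hq) (t := 1 - t) (by linarith) (by linarith)))).comp_measurable hTm.measurable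
  have hm1 : AEStronglyMeasurable (fun p => G (contr q (1 - t) p) - G p) (μ.restrict U) :=
    ((hGc.comp hTm).sub hGc).aestronglyMeasurable
  have heq : (fun p => F (contr q (1 - t) p) - F p) =
      (((F - G) ∘ contr q (1 - t)) - (F - G)) + fun p => G (contr q (1 - t) p) - G p := by
    ext p
    simp only [Pi.add_apply, Pi.sub_apply, Function.comp_apply]
    ring
  rw [heq]
  calc _ ≤ eLpNorm (((F - G) ∘ contr q (1 - t)) - (F - G)) 2 (μ.restrict U) +
        eLpNorm (fun p => G (contr q (1 - t) p) - G p) 2 (μ.restrict U) :=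
        eLpNorm_add_le (hm2.sub hFGm) hm1 one_le_two
    _ ≤ (eLpNorm ((F - G) ∘ contr q (1 - t)) 2 (μ.restrict U) + eLpNorm (F - G) 2 (μ.restrict U)) +
        ε / 2 := by
        gcongr
        exact eLpNorm_sub_le hm2 hFGm one_le_two
    _ ≤ (c * ε₁ + ε₁) + ε / 2 := by
        gcongr
        exact h2.trans (by gcongr)
    _ = ε₁ * (c + 1) + ε / 2 := by ring
    _ ≤ ε / 2 + ε / 2 := by gcongr
    _ = ε := ENNReal.add_halves ε

end Contraction

/-! ### Density of smooth functions in `H^s` of a convex domain -/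

section Density

variable {d : ℕ}

/-- The probability measure whose density is a normalised bump function. -/
noncomputable def bumpMeasure (f : ContDiffBump (0 : Euc d)) : Measure (Euc d) :=
  volume.withDensity fun u => ((f.normed volume u).toNNReal : ℝ≥0∞)

theorem measurable_bump (f : ContDiffBump (0 : Euc d)) :
    Measurable fun u => (f.normed volume u).toNNReal :=
  (f.continuous_normed (μ := volume)).measurable.real_toNNReal

instance isProbabilityMeasure_bumpMeasure (f : ContDiffBump (0 : Euc d)) :
    IsProbabilityMeasure (bumpMeasure f) := by
  refine ⟨?_⟩
  rw [bumpMeasure, withDensity_apply _ MeasurableSet.univ, Measure.restrict_univ]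
  change ∫⁻ u, ENNReal.ofReal (f.normed volume u) = 1
  rw [← ofReal_integral_eq_lintegral_ofReal f.integrable_normed
    (ae_of_all _ fun u => f.nonneg_normed u), f.integral_normed, ENNReal.ofReal_one]

theorem ae_bumpMeasure_norm_lt (f : ContDiffBump (0 : Euc d)) :
    ∀ᵐ u ∂bumpMeasure f, ‖u‖ < f.rOut := by
  rw [bumpMeasure, ae_withDensity_iff (measurable_bump f).coe_nnreal_ennreal]
  refine ae_of_all _ fun u hu => ?_
  have h : u ∈ Function.support (f.normed volume) := fun h => hu (by simp [h])
  rw [f.support_normed_eq] at h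
  simpa using h

theorem integrable_bumpMeasure (f : ContDiffBump (0 : Euc d)) {w : Euc d → ℝ}
    (hw : LocallyIntegrable w) (y : Euc d) : Integrable (fun u => w (y - u)) (bumpMeasure f) := by
  rw [bumpMeasure, integrable_withDensity_iff_integrable_smul (measurable_bump f)]
  have h := f.hasCompactSupport_normed.convolutionExists_left (ContinuousLinearMap.lsmul ℝ ℝ)
    (f.continuous_normed (μ := volume)) hw y
  refine h.congr (ae_of_all _ fun u => ?_)
  simp [NNReal.smul_def, Real.coe_toNNReal _ (f.nonneg_normed u)]

theorem contDiff_average (f : ContDiffBump (0 : Euc d)) {w : Euc d → ℝ}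
    (hw : LocallyIntegrable w) : ContDiff ℝ ∞ fun y => ∫ u, w (y - u) ∂bumpMeasure f := by
  convert f.hasCompactSupport_normed.contDiff_convolution_left (ContinuousLinearMap.lsmul ℝ ℝ)
    (n := ⊤) (f.contDiff_normed (μ := volume)) hw using 1
  ext y
  rw [convolution_def, bumpMeasure, integral_withDensity_eq_integral_smul (measurable_bump f)]
  refine integral_congr_ae (ae_of_all _ fun u => ?_)
  simp [NNReal.smul_def, Real.coe_toNNReal _ (f.nonneg_normed u)]

theorem contr_prod (q p : Euc d × Euc d) (t : ℝ) :
    contr q t p = (contr q.1 t p.1, contr q.2 t p.2) := rfl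

/-- Contracting a function contracts its difference quotient in `U × U` about the diagonal point
`(q, q)`, up to a power of the ratio. Continuity in the Gagliardo seminorm thus reduces to `L²`
continuity on the product domain. -/
theorem quot_contr (s : ℝ) (w : Euc d → ℝ) (q : Euc d) {t : ℝ} (ht : 0 < t) (p : Euc d × Euc d) :
    (w (contr q t p.1) - w (contr q t p.2)) / ‖p.1 - p.2‖ ^ (((d : ℝ) + 2 * s) / 2) =
      t ^ (((d : ℝ) + 2 * s) / 2) * quot s w (contr (q, q) t p) := by
  have h : t ^ (((d : ℝ) + 2 * s) / 2) ≠ 0 := (Real.rpow_pos_of_pos ht _).ne'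
  rw [quot, contr_prod]
  simp only [contr_sub_contr]
  rw [norm_smul, Real.norm_of_nonneg ht.le, Real.mul_rpow ht.le (norm_nonneg _), mul_div_assoc',
    mul_div_mul_left _ _ h]

variable {s : ℝ} {U : Set (Euc d)}

theorem eLpNorm_scaled_quot_sub_le (hs : 0 ≤ s) {w : Euc d → ℝ}
    (hw : Measurable w) {q : Euc d} {t : ℝ} (ht : 0 < t) (ht1 : t ≤ 1) {ε₁ ε₂ : ℝ≥0∞}
    (h1 : eLpNorm (fun p => quot s w (contr (q, q) t p) - quot s w p) 2
      ((volume.restrict U).prod (volume.restrict U)) ≤ ε₁)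
    (h2 : ENNReal.ofReal (1 - t ^ (((d : ℝ) + 2 * s) / 2)) *
      eLpNorm (quot s w) 2 ((volume.restrict U).prod (volume.restrict U)) ≤ ε₂) :
    eLpNorm (fun p => t ^ (((d : ℝ) + 2 * s) / 2) * quot s w (contr (q, q) t p) - quot s w p) 2
      ((volume.restrict U).prod (volume.restrict U)) ≤ ε₁ + ε₂ := by
  set a := t ^ (((d : ℝ) + 2 * s) / 2)
  have ha0 : 0 ≤ a := Real.rpow_nonneg ht.le _
  have ha1 : a ≤ 1 := Real.rpow_le_one ht.le ht1 (by positivity)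
  have hq := measurable_quot s hw
  have hqc : Measurable fun p => quot s w (contr (q, q) t p) :=
    hq.comp (continuous_contr _ _).measurable
  have heq : (fun p => a * quot s w (contr (q, q) t p) - quot s w p) =
      a • (fun p => quot s w (contr (q, q) t p) - quot s w p) - (1 - a) • quot s w := by
    ext p
    simp only [Pi.sub_apply, Pi.smul_apply, smul_eq_mul]
    ring
  rw [heq]
  refine (eLpNorm_sub_le ((hqc.sub hq).const_smul a).aestronglyMeasurable
    (hq.const_smul (1 - a)).aestronglyMeasurable one_le_two).trans (add_le_add ?_ ?_)
  · rw [eLpNorm_const_smul, Real.enorm_eq_ofReal ha0]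
    refine le_trans ?_ h1
    exact mul_le_of_le_one_left' (by simpa using ha1)
  · rwa [eLpNorm_const_smul, Real.enorm_eq_ofReal (by linarith)]

theorem measurable_uncurry_quotient {X Y : Type*} [MeasurableSpace X] [MeasurableSpace Y]
    {W : X × Y → ℝ} {D V : Y × Y → ℝ} (hW : Measurable W) (hD : Measurable D) (hV : Measurable V) :
    Measurable (Function.uncurry fun u p => (W (u, p.1) - W (u, p.2)) / D p - V p) := by
  unfold Function.uncurry
  fun_prop

/-- The approximant is a mollification of `w` composed with a slight contraction towards `x₀`. A
shift of a contraction is a contraction about another centre, so the approximant is an average of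
contractions of `w` centred in `U`, and Minkowski's inequality reduces both estimates to a single
contraction. -/
theorem exists_contDiff_close (hs : 0 ≤ s) (hU : Convex ℝ U) (ho : IsOpen U)
    (hUb : Bornology.IsBounded U) (hne : U.Nonempty) {w : Euc d → ℝ} (hwm : Measurable w)
    (hw0 : ∀ x ∉ U, w x = 0) (hw : MemLp w 2 (volume.restrict U)) (hg : gagliardoSq s U w < ⊤)
    {ε : ℝ≥0∞} (hε : ε ≠ 0) :
    ∃ φ : Euc d → ℝ, ContDiff ℝ ∞ φ ∧ eLpNorm (w - φ) 2 (volume.restrict U) ≤ ε ∧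
      eLpNorm (quot s (w - φ)) 2 ((volume.restrict U).prod (volume.restrict U)) ≤ ε := by
  have : IsFiniteMeasure (volume.restrict U) :=
    isFiniteMeasure_restrict.2 hUb.measure_lt_top.ne
  set μ := volume.restrict U with hμ
  have hprod : μ.prod μ = ((volume : Measure (Euc d)).prod volume).restrict (U ×ˢ U) :=
    Measure.prod_restrict U U
  have hQ : MemLp (quot s w) 2 (μ.prod μ) := by
    refine ⟨(measurable_quot s hwm).aestronglyMeasurable, ?_⟩
    rw [gagliardoSq_eq] at hg
    exact (ENNReal.pow_lt_top_iff.1 hg).resolve_right two_ne_zero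
  -- Vanishing outside `U` makes the convolution meaningful on all of `ℝ^d`, so the approximant is
  -- smooth up to the boundary and beyond.
  have hloc : LocallyIntegrable w := by
    refine ((integrableOn_iff_integrable_of_support_subset (s := U) fun x hx => ?_).1
      (hw.integrable one_le_two)).locallyIntegrable
    by_contra h
    exact hx (hw0 x h)
  obtain ⟨x₀, hx₀⟩ := hne
  obtain ⟨r, hr, hball⟩ := Metric.isOpen_iff.1 ho x₀ hx₀
  obtain ⟨δ₁, hδ₁, h₁⟩ := exists_eLpNorm_contr_sub_le volume hU ho hUb hw hε
  have hε2 : ε / 2 ≠ 0 := (ENNReal.half_pos hε).ne'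
  obtain ⟨δ₂, hδ₂, h₂⟩ := exists_eLpNorm_contr_sub_le
    ((volume : Measure (Euc d)).prod volume) (hU.prod hU) (ho.prod ho) (hUb.prod hUb)
    (hprod ▸ hQ) hε2
  set β := ((d : ℝ) + 2 * s) / 2
  -- This threshold absorbs the scalar factor `(1 - t)^β` of `quot_contr`, which tends to 1.
  obtain ⟨δ₃, hδ₃, h₃⟩ : ∃ δ₃ : ℝ, 0 < δ₃ ∧ ∀ t : ℝ, 0 < t → t < δ₃ →
      ENNReal.ofReal (1 - (1 - t) ^ β) * eLpNorm (quot s w) 2 (μ.prod μ) ≤ ε / 2 := by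
    have hlim : Tendsto (fun t : ℝ =>
        ENNReal.ofReal (1 - (1 - t) ^ β) * eLpNorm (quot s w) 2 (μ.prod μ)) (𝓝 0) (𝓝 0) := by
      have hc : ContinuousAt (fun t : ℝ => 1 - (1 - t) ^ β) 0 :=
        continuousAt_const.sub ((continuousAt_const.sub continuousAt_id).rpow_const
          (Or.inl (by simp)))
      have := ENNReal.Tendsto.mul_const (b := eLpNorm (quot s w) 2 (μ.prod μ))
        (ENNReal.tendsto_ofReal hc.tendsto) (Or.inr hQ.2.ne)
      simpa using this
    obtain ⟨δ₃, hδ₃, h⟩ := Metric.eventually_nhds_iff.1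
      (hlim.eventually (eventually_le_nhds (pos_iff_ne_zero.2 hε2)))
    exact ⟨δ₃, hδ₃, fun t ht htδ => h (by simpa [abs_of_pos ht] using htδ)⟩
  obtain ⟨t, ht0, htlt⟩ : ∃ t : ℝ, 0 < t ∧ t < min (min δ₁ δ₂) (min δ₃ (1 / 2)) :=
    exists_between (by positivity)
  simp only [lt_min_iff] at htlt
  obtain ⟨⟨ht1, ht2⟩, ht3, ht4⟩ := htlt
  -- The mollification radius `t * r` is tied to the contraction: for `‖u‖ < t * r` the new centre
  -- `x₀ - t⁻¹ • u` stays in the ball of radius `r` about `x₀`, inside `U`.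
  let f : ContDiffBump (0 : Euc d) := ⟨t * r / 2, t * r, by positivity, by
    have : 0 < t * r := by positivity
    linarith⟩
  let ν := bumpMeasure f
  let q : Euc d → Euc d := fun u => x₀ - t⁻¹ • u
  have hq : ∀ᵐ u ∂ν, q u ∈ U := by
    filter_upwards [ae_bumpMeasure_norm_lt f] with u hu
    refine hball ?_
    rw [Metric.mem_ball, dist_eq_norm, sub_sub_cancel_left, norm_neg, norm_smul,
      Real.norm_of_nonneg (by positivity), inv_mul_lt_iff₀ ht0]
    exact hu
  have hTq : ∀ u x, (1 - t) • x + t • x₀ - u = contr (q u) (1 - t) x := fun u x => by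
    simp only [contr, q, sub_sub_cancel, smul_sub, smul_inv_smul₀ ht0.ne']
    abel
  let φ : Euc d → ℝ := fun x => ∫ u, w ((1 - t) • x + t • x₀ - u) ∂ν
  have hint : ∀ x, Integrable (fun u => w (contr (q u) (1 - t) x)) ν := fun x => by
    simp_rw [← hTq]
    exact integrable_bumpMeasure f hloc _
  have hφ : ∀ x, φ x = ∫ u, w (contr (q u) (1 - t) x) ∂ν := fun x => by
    simp_rw [← hTq]; rfl
  have hcq : Continuous fun z : Euc d × Euc d => contr (q z.1) (1 - t) z.2 := by
    simp_rw [← hTq]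
    fun_prop
  refine ⟨φ, ?_, ?_, ?_⟩
  · exact (contDiff_average f hloc).comp (by fun_prop : ContDiff ℝ ∞ fun x : Euc d =>
      (1 - t) • x + t • x₀)
  · have heq : φ - w = fun x => ∫ u, (w (contr (q u) (1 - t) x) - w x) ∂ν := by
      ext x
      rw [integral_sub (hint x) (integrable_const _), integral_const, Pi.sub_apply, hφ]
      simp
    rw [eLpNorm_sub_comm, heq]
    refine eLpNorm_two_average_le ?_ ?_
    · exact (hwm.comp hcq.measurable).sub (hwm.comp measurable_snd)
    · filter_upwards [hq] with u hu
      exact h₁ t ht0 ht4.le ht1.le _ hu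
  · have heq : quot s (φ - w) = fun p => ∫ u, ((w (contr (q u) (1 - t) p.1) -
        w (contr (q u) (1 - t) p.2)) / ‖p.1 - p.2‖ ^ β - quot s w p) ∂ν := by
      ext p
      have hint2 : Integrable (fun u => (w (contr (q u) (1 - t) p.1) -
          w (contr (q u) (1 - t) p.2)) / ‖p.1 - p.2‖ ^ β) ν :=
        ((hint p.1).sub (hint p.2)).div_const _
      rw [quot_sub, Pi.sub_apply, integral_sub hint2 (integrable_const _), integral_div, integral_sub (hint p.1) (hint p.2), integral_const]
      simp [quot, hφ, β]
    have hcomm : eLpNorm (quot s (w - φ)) 2 (μ.prod μ) = eLpNorm (quot s (φ - w)) 2 (μ.prod μ) := by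
      rw [quot_sub, quot_sub, eLpNorm_sub_comm]
    rw [hcomm, heq]
    refine eLpNorm_two_average_le ?_ ?_
    · exact measurable_uncurry_quotient (W := fun z => w (contr (q z.1) (1 - t) z.2))
        (hwm.comp hcq.measurable) (D := fun p => ‖p.1 - p.2‖ ^ β) (by fun_prop)
        (measurable_quot s hwm)
    · filter_upwards [hq] with u hu
      have ht' : 0 < 1 - t := by linarith
      simp_rw [β, quot_contr s w (q u) ht']
      rw [← ENNReal.add_halves ε]
      refine eLpNorm_scaled_quot_sub_le hs hwm ht' (by linarith) ?_ (h₃ t ht0 ht3)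
      rw [← hμ, hprod]
      exact h₂ t ht0 ht4.le ht2.le _ ⟨hu, hu⟩

/-! ### Independence of representatives and approximating sequences. -/

theorem quot_ae_eq {v w : Euc d → ℝ} (h : v =ᵐ[volume.restrict U] w) :
    quot s v =ᵐ[(volume.restrict U).prod (volume.restrict U)] quot s w := by
  filter_upwards [Measure.quasiMeasurePreserving_fst.ae h, Measure.quasiMeasurePreserving_snd.ae h]
    with p h1 h2
  rw [quot, quot, h1, h2]

theorem aestronglyMeasurable_quot {w : Euc d → ℝ}
    (hw : AEStronglyMeasurable w (volume.restrict U)) :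
    AEStronglyMeasurable (quot s w) ((volume.restrict U).prod (volume.restrict U)) := by
  obtain ⟨w₁, hw₁m, hw₁⟩ := hw
  exact (measurable_quot s hw₁m.measurable).aestronglyMeasurable.congr (quot_ae_eq hw₁).symm

theorem gagliardoSq_congr {v w : Euc d → ℝ} (h : v =ᵐ[volume.restrict U] w) :
    gagliardoSq s U v = gagliardoSq s U w := by
  rw [gagliardoSq_eq, gagliardoSq_eq, eLpNorm_congr_ae (quot_ae_eq h)]

theorem l2Sq_congr {μ : Measure (Euc d)} {v w : Euc d → ℝ} (h : v =ᵐ[μ] w) :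
    l2Sq μ v = l2Sq μ w := by
  rw [l2Sq_eq, l2Sq_eq, eLpNorm_congr_ae h]

/-- Smooth functions are dense in `H^s` of a bounded convex open set. -/
theorem exists_seq_contDiff_tendsto (hs : 0 ≤ s) (hU : Convex ℝ U) (ho : IsOpen U)
    (hUb : Bornology.IsBounded U) (hne : U.Nonempty) {w : Euc d → ℝ}
    (hw : MemLp w 2 (volume.restrict U)) (hg : gagliardoSq s U w < ⊤) :
    ∃ φ : ℕ → Euc d → ℝ, (∀ n, ContDiff ℝ ∞ (φ n)) ∧
      Tendsto (fun n => l2Sq (volume.restrict U) (w - φ n) + gagliardoSq s U (w - φ n))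
        atTop (𝓝 0) := by
  obtain ⟨w₁, hw₁m, hw₁⟩ := hw.aestronglyMeasurable
  have hwe : w =ᵐ[volume.restrict U] U.indicator w₁ := by
    filter_upwards [hw₁, ae_restrict_mem ho.measurableSet] with x hx hxU
    rw [hx, Set.indicator_of_mem hxU]
  have hε : ∀ n : ℕ, ((n : ℝ≥0∞) + 1)⁻¹ ≠ 0 := fun n => ENNReal.inv_ne_zero.2 (by finiteness)
  have hex := fun n : ℕ => exists_contDiff_close hs hU ho hUb hne
    (hw₁m.measurable.indicator ho.measurableSet) (fun x hx => Set.indicator_of_notMem hx _)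
    (hw.ae_eq hwe) (gagliardoSq_congr (s := s) hwe ▸ hg) (hε n)
  choose φ hφ h1 h2 using hex
  refine ⟨φ, hφ, ?_⟩
  have hlim : Tendsto (fun n : ℕ => (((n : ℝ≥0∞) + 1)⁻¹) ^ 2 + (((n : ℝ≥0∞) + 1)⁻¹) ^ 2)
      atTop (𝓝 0) := by
    have h : Tendsto (fun n : ℕ => ((n : ℝ≥0∞) + 1)⁻¹) atTop (𝓝 0) := by
      have := (ENNReal.tendsto_inv_nat_nhds_zero).comp (tendsto_add_atTop_nat 1)
      simpa [Function.comp_def] using this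
    simpa using (ENNReal.Tendsto.pow (n := 2) h).add (ENNReal.Tendsto.pow (n := 2) h)
  refine tendsto_of_tendsto_of_tendsto_of_le_of_le tendsto_const_nhds hlim (fun n => zero_le) ?_
  intro n
  have hsub : w - φ n =ᵐ[volume.restrict U] U.indicator w₁ - φ n := hwe.sub (ae_eq_refl _)
  simp only
  rw [l2Sq_congr hsub, gagliardoSq_congr hsub, l2Sq_eq, gagliardoSq_eq]
  gcongr
  · exact h1 n
  · exact h2 n

end Density

/-! ### Traces of functions in `H^s` -/

section Trace

variable {d : ℕ} {s : ℝ} {U : Set (Euc d)}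

theorem sq_eLpNorm_sub_le {α : Type*} [MeasurableSpace α] {μ : Measure α} {f g : α → ℝ}
    (hf : AEStronglyMeasurable f μ) (hg : AEStronglyMeasurable g μ) :
    eLpNorm (f - g) 2 μ ^ 2 ≤ 2 * eLpNorm f 2 μ ^ 2 + 2 * eLpNorm g 2 μ ^ 2 :=
  (pow_le_pow_left₀ zero_le (eLpNorm_sub_le hf hg one_le_two) 2).trans
    (sq_add_le_two_mul _ _)

/-- The squared norm of `H^s(U)` with weight `H` on the seminorm. -/
noncomputable def hsSq (H : ℝ≥0∞) (s : ℝ) (U : Set (Euc d)) (w : Euc d → ℝ) : ℝ≥0∞ :=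
  l2Sq (volume.restrict U) w + H * gagliardoSq s U w

theorem hsSq_sub_le (H : ℝ≥0∞) {v w : Euc d → ℝ} (hv : AEStronglyMeasurable v (volume.restrict U))
    (hw : AEStronglyMeasurable w (volume.restrict U)) :
    hsSq H s U (v - w) ≤ 2 * hsSq H s U v + 2 * hsSq H s U w := by
  have h1 := sq_eLpNorm_sub_le hv hw
  have h2 := sq_eLpNorm_sub_le (aestronglyMeasurable_quot (s := s) hv)
    (aestronglyMeasurable_quot (s := s) hw)
  rw [← quot_sub, ← gagliardoSq_eq, ← gagliardoSq_eq, ← gagliardoSq_eq] at h2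
  rw [← l2Sq_eq, ← l2Sq_eq, ← l2Sq_eq] at h1
  calc hsSq H s U (v - w) ≤ (2 * l2Sq (volume.restrict U) v + 2 * l2Sq (volume.restrict U) w) +
        H * (2 * gagliardoSq s U v + 2 * gagliardoSq s U w) := by
        unfold hsSq; gcongr
    _ = _ := by unfold hsSq; ring

theorem tendsto_hsSq {H : ℝ≥0∞} (hH : H ≠ ⊤) {v : ℕ → Euc d → ℝ}
    (h : Tendsto (fun n => l2Sq (volume.restrict U) (v n) + gagliardoSq s U (v n)) atTop (𝓝 0)) :
    Tendsto (fun n => hsSq H s U (v n)) atTop (𝓝 0) := by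
  have hlim := ENNReal.Tendsto.const_mul (a := 1 + H) h (Or.inr (by finiteness))
  rw [mul_zero] at hlim
  refine tendsto_of_tendsto_of_tendsto_of_le_of_le tendsto_const_nhds hlim (fun _ => zero_le) ?_
  intro n
  simp only [hsSq, add_mul, mul_add, one_mul]
  exact add_le_add le_self_add le_add_self |>.trans (by rw [add_comm (_ + _)])

variable {σ : Measure (Euc d)} {A H : ℝ≥0∞} {w : Euc d → ℝ}

/-- A trace inequality for continuous functions extends to all traces. -/
theorem IsTrace.l2Sq_le (hA : A ≠ ⊤) (hH : H ≠ ⊤)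
    (hcont : ∀ φ : Euc d → ℝ, Continuous φ → l2Sq σ φ ≤ A * hsSq H s U φ)
    (hw : MemLp w 2 (volume.restrict U)) {g : Euc d → ℝ} (hg : IsTrace s U σ w g) :
    l2Sq σ g ≤ 4 * A * hsSq H s U w := by
  obtain ⟨hgm, φ, hφ, hφw, hφg⟩ := hg
  -- Split `g = (g - φ n) + φ n` and `φ n = w - (w - φ n)`; each squared triangle inequality costs a
  -- factor 2, so `4 * A` remains in the limit.
  have hmain : ∀ n, l2Sq σ g ≤ 2 * l2Sq σ (g - φ n) +
      2 * (A * (2 * hsSq H s U w + 2 * hsSq H s U (w - φ n))) := fun n => by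
    have hc := (hφ n).continuous
    have h1 := sq_eLpNorm_sub_le (hgm.aestronglyMeasurable.sub hc.aestronglyMeasurable)
      (hc.neg.aestronglyMeasurable (μ := σ))
    have h2 := hsSq_sub_le (s := s) H hw.aestronglyMeasurable
      (hw.aestronglyMeasurable.sub hc.aestronglyMeasurable)
    rw [sub_sub_cancel] at h2
    rw [sub_neg_eq_add, sub_add_cancel, eLpNorm_neg, ← l2Sq_eq, ← l2Sq_eq, ← l2Sq_eq] at h1
    refine h1.trans ?_
    gcongr
    exact (hcont _ hc).trans (by gcongr)
  have hlim : Tendsto (fun n => 2 * l2Sq σ (g - φ n) +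
      2 * (A * (2 * hsSq H s U w + 2 * hsSq H s U (w - φ n)))) atTop
      (𝓝 (2 * 0 + 2 * (A * (2 * hsSq H s U w + 2 * 0)))) := by
    refine (ENNReal.Tendsto.const_mul hφg (Or.inr (by finiteness))).add ?_
    refine ENNReal.Tendsto.const_mul (ENNReal.Tendsto.const_mul ?_ (Or.inr hA))
      (Or.inr (by finiteness))
    exact tendsto_const_nhds.add
      (ENNReal.Tendsto.const_mul (tendsto_hsSq hH hφw) (Or.inr (by finiteness)))
  refine (ge_of_tendsto' hlim hmain).trans (le_of_eq ?_)
  ring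

/-- If continuous functions satisfy a trace inequality, every function of `H^s` has a trace. -/
theorem exists_isTrace (hs : 0 ≤ s) (hU : Convex ℝ U) (ho : IsOpen U)
    (hUb : Bornology.IsBounded U) (hne : U.Nonempty) (hA : A ≠ ⊤) (hH : H ≠ ⊤)
    (hcont : ∀ φ : Euc d → ℝ, Continuous φ → l2Sq σ φ ≤ A * hsSq H s U φ)
    (hσ : ∀ φ : Euc d → ℝ, Continuous φ → MemLp φ 2 σ)
    (hw : MemLp w 2 (volume.restrict U)) (hg : gagliardoSq s U w < ⊤) :
    ∃ g, IsTrace s U σ w g := by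
  obtain ⟨φ, hφ, hφw⟩ := exists_seq_contDiff_tendsto hs hU ho hUb hne hw hg
  have hm : ∀ n, MemLp (φ n) 2 σ := fun n => hσ _ (hφ n).continuous
  have hE : Tendsto (fun n => A * (2 * hsSq H s U (w - φ n))) atTop (𝓝 0) := by
    have := ENNReal.Tendsto.const_mul (a := A) (ENNReal.Tendsto.const_mul (a := 2)
      (tendsto_hsSq hH hφw) (Or.inr (by finiteness))) (Or.inr hA)
    simpa using this
  -- The inequality for continuous functions, applied to `φ n - φ k`, turns convergence in `H^s(U)`
  -- into the Cauchy property in `L²(σ)`.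
  have hdiff : ∀ n k, eLpNorm (φ n - φ k) 2 σ ^ 2 ≤
      A * (2 * hsSq H s U (w - φ k)) + A * (2 * hsSq H s U (w - φ n)) := fun n k => by
    have hk := (hφ k).continuous
    have hn := (hφ n).continuous
    have h := hsSq_sub_le (s := s) H (hw.aestronglyMeasurable.sub hk.aestronglyMeasurable)
      (hw.aestronglyMeasurable.sub hn.aestronglyMeasurable)
    rw [sub_sub_sub_cancel_left] at h
    rw [← l2Sq_eq, ← mul_add]
    exact (hcont _ (hn.sub hk)).trans (by gcongr)
  have hcauchy : CauchySeq fun n => (hm n).toLp (φ n) := by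
    rw [EMetric.cauchySeq_iff]
    intro ε hε
    have hε' : ε ^ 2 / 2 ≠ 0 := (ENNReal.half_pos (pow_ne_zero 2 hε.ne')).ne'
    obtain ⟨N, hN⟩ := eventually_atTop.1 (hE.eventually (eventually_lt_nhds
      (pos_iff_ne_zero.2 hε')))
    refine ⟨N, fun n hn k hk => ?_⟩
    rw [Lp.edist_toLp_toLp, ← ENNReal.pow_lt_pow_left_iff two_ne_zero]
    calc _ ≤ _ := hdiff n k
      _ < ε ^ 2 / 2 + ε ^ 2 / 2 := ENNReal.add_lt_add (hN k hk) (hN n hn)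
      _ = ε ^ 2 := ENNReal.add_halves _
  obtain ⟨g, hgl⟩ := cauchySeq_tendsto_of_complete hcauchy
  refine ⟨g, Lp.memLp g, φ, hφ, hφw, ?_⟩
  rw [tendsto_iff_edist_tendsto_0] at hgl
  have hsq := ENNReal.Tendsto.pow (n := 2) hgl
  rw [zero_pow two_ne_zero] at hsq
  refine hsq.congr fun n => ?_
  rw [edist_comm, Lp.edist_def, l2Sq_eq]
  congr 1
  exact eLpNorm_congr_ae ((ae_eq_refl _).sub (hm n).coeFn_toLp)

end Trace

/-! ### The trace inequality on regular elements -/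

section Element

variable {d : ℕ}

theorem memLp_faceMeasure [NeZero d] (K : Affine.Simplex ℝ (Euc d) d) (e : Fin (d + 1))
    {φ : Euc d → ℝ} (hφ : Continuous φ) : MemLp φ 2 (faceMeasure K e) := by
  obtain ⟨C, hC⟩ := (isCompact_body K).exists_bound_of_continuousOn hφ.continuousOn
  refine MemLp.of_bound hφ.aestronglyMeasurable C ?_
  filter_upwards [ae_faceMeasure_mem_face K e] with x hx
  exact hC x (face_subset_body K e hx)

/-- The lower bound of `|K| / h_K ^ d` for elements of regularity `ν`. -/
noncomputable def volConst (d : ℕ) (ν : ℝ) : ℝ :=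
  ((4 * ν ^ 2)⁻¹) ^ d * (volume (Metric.ball (0 : Euc d) 1)).toReal

theorem volConst_pos {ν : ℝ} (hν : 0 < ν) : 0 < volConst d ν :=
  mul_pos (by positivity)
    (ENNReal.toReal_pos (Metric.measure_ball_pos _ _ one_pos).ne' measure_ball_lt_top.ne)

theorem MeshRegular.volConst_mul_le {ν : ℝ} {K : Affine.Simplex ℝ (Euc d) d}
    (hK : MeshRegular ν K) (hd : 2 ≤ d) {ν' : ℝ} (hν : ν ≤ ν') (hν' : 0 < ν') :
    ENNReal.ofReal (volConst d ν' * elemDiam K ^ d) ≤ volume (elem K) := by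
  obtain ⟨x, hx⟩ := hK.exists_ball hd hν hν'
  have hE : 0 ≤ elemDiam K := Metric.diam_nonneg
  have : Nontrivial (Euc d) := by
    have : Nonempty (Fin d) := ⟨⟨0, by omega⟩⟩
    infer_instance
  refine le_trans (le_of_eq ?_) (measure_mono hx)
  rw [Measure.addHaar_ball _ _ (by positivity), finrank_euclideanSpace_fin, volConst,
    mul_right_comm, ← mul_pow, ENNReal.ofReal_mul (by positivity),
    ENNReal.ofReal_toReal measure_ball_lt_top.ne, div_eq_inv_mul]

theorem MeshRegular.l2Sq_faceMeasure_le {s ν ν' : ℝ} {K : Affine.Simplex ℝ (Euc d) d}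
    (hK : MeshRegular ν K) (hd : 2 ≤ d) (hs : 1 / 2 < s) (hν : ν ≤ ν') (hν' : 0 < ν')
    (e : Fin (d + 1)) {φ : Euc d → ℝ} (hφ : Continuous φ) :
    l2Sq (faceMeasure K e) φ ≤
      ENNReal.ofReal (traceConst d s (volConst d ν') (ballConst d) * (elemDiam K)⁻¹) *
        hsSq (ENNReal.ofReal (elemDiam K ^ (2 * s))) s (elem K) φ := by
  have : NeZero d := ⟨by omega⟩
  refine l2Sq_le_of_continuous (by omega) hs (convex_elem K) (isOpen_elem K) (isBounded_elem K)
    ?_ ((faceDiam_pos K e hd).trans_le (faceDiam_le_elemDiam K e)) ?_ (ballConst_nonneg d)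
    (fun y r hr => faceMeasure_closedBall_le K e (by omega) y hr) (volConst_pos hν')
    (hK.volConst_mul_le hd hν hν') hφ
  · filter_upwards [ae_faceMeasure_mem_face K e] with x hx
    rw [closure_elem]
    exact face_subset_body K e hx
  · rw [closure_elem]
    exact fun x hx y hy => Metric.dist_le_diam_of_mem (isCompact_body K).isBounded hx hy

theorem traceConst_nonneg {s c M : ℝ} (hc : 0 ≤ c) (hM : 0 ≤ M) : 0 ≤ traceConst d s c M := by
  unfold traceConst stepConst
  positivity

theorem MemH1.memLp_weakPartial {U : Set (Euc d)} {v : Euc d → ℝ} (hv : MemH1 U v) (i : Fin d) :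
    MemLp (weakPartial U i v) 2 (volume.restrict U) := by
  rw [weakPartial, dif_pos (hv.2 i)]
  exact (hv.2 i).choose_spec.1

end Element

end TraceIneq

/-! ### The inequality for gradients, uniformly over regular elements. -/

open TraceIneq in
theorem mainTheorem5 (d : ℕ) (hd : d = 2 ∨ d = 3) (s : ℝ) (hs : s ∈ Set.Ioo (1 / 2 : ℝ) 1)
    (ν : ℝ) :
    ∃ C : ℝ, 0 < C ∧
      ∀ (K : Affine.Simplex ℝ (TraceIneq.Euc d) d), TraceIneq.MeshRegular ν K →
      ∀ (e : Fin (d + 1)) (v : TraceIneq.Euc d → ℝ),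
        TraceIneq.MemH1s s (TraceIneq.elem K) v →
        (∃ g : Fin d → TraceIneq.Euc d → ℝ, ∀ i,
          TraceIneq.IsTrace s (TraceIneq.elem K) (TraceIneq.faceMeasure K e)
            (TraceIneq.weakPartial (TraceIneq.elem K) i v) (g i)) ∧
        ∀ g : Fin d → TraceIneq.Euc d → ℝ,
          (∀ i, TraceIneq.IsTrace s (TraceIneq.elem K) (TraceIneq.faceMeasure K e)
            (TraceIneq.weakPartial (TraceIneq.elem K) i v) (g i)) →
          ∑ i, TraceIneq.l2Sq (TraceIneq.faceMeasure K e) (g i) ≤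
            ENNReal.ofReal (C * (TraceIneq.faceDiam K e)⁻¹) *
              (TraceIneq.h1SeminormSq (TraceIneq.elem K) v +
                ENNReal.ofReal (TraceIneq.elemDiam K ^ (2 * s)) *
                  TraceIneq.h1sSeminormSq s (TraceIneq.elem K) v) := by
  have hd2 : 2 ≤ d := by omega
  have : NeZero d := ⟨by omega⟩
  -- Replacing `ν` by `|ν| + 1` only weakens the mesh condition and makes the volume constant
  -- positive for every real `ν`.
  have hν' : 0 < |ν| + 1 := by positivity
  have hν : ν ≤ |ν| + 1 := (le_abs_self ν).trans (by linarith)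
  set T := traceConst d s (volConst d (|ν| + 1)) (ballConst d)
  have hT : 0 ≤ T := traceConst_nonneg (volConst_pos hν').le (ballConst_nonneg d)
  -- The 4 comes from passing to the limit in `IsTrace.l2Sq_le`; the 1 ensures strict positivity, as
  -- only `0 ≤ T` is known.
  refine ⟨4 * T + 1, by positivity, fun K hK e v hv => ?_⟩
  have hcont := fun φ (hφ : Continuous φ) => hK.l2Sq_faceMeasure_le hd2 hs.1 hν hν' e hφ
  have hw := fun i => hv.1.memLp_weakPartial i
  have hgag : ∀ i, gagliardoSq s (elem K) (weakPartial (elem K) i v) < ⊤ := fun i =>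
    ENNReal.sum_lt_top.1 hv.2 i (Finset.mem_univ i)
  refine ⟨?_, fun g hg => ?_⟩
  · choose g hg using fun i => exists_isTrace (by linarith [hs.1]) (convex_elem K) (isOpen_elem K)
      (isBounded_elem K) (elem_nonempty K) ENNReal.ofReal_ne_top ENNReal.ofReal_ne_top hcont
      (fun φ hφ => memLp_faceMeasure K e hφ) (hw i) (hgag i)
    exact ⟨g, hg⟩
  · have hf := faceDiam_pos K e hd2
    have hle := faceDiam_le_elemDiam K e
    -- Here `h_K⁻¹` becomes `h_e⁻¹`, by `h_e ≤ h_K`.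
    have hcoef : 4 * ENNReal.ofReal (T * (elemDiam K)⁻¹) ≤
        ENNReal.ofReal ((4 * T + 1) * (faceDiam K e)⁻¹) := by
      rw [← ENNReal.ofReal_ofNat, ← ENNReal.ofReal_mul (by positivity), ← mul_assoc]
      have := hf.trans_le hle
      gcongr
      linarith
    calc ∑ i, l2Sq (faceMeasure K e) (g i)
        ≤ ∑ i, ENNReal.ofReal ((4 * T + 1) * (faceDiam K e)⁻¹) *
            hsSq (ENNReal.ofReal (elemDiam K ^ (2 * s))) s (elem K)
              (weakPartial (elem K) i v) := by
          refine Finset.sum_le_sum fun i _ => ?_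
          exact ((hg i).l2Sq_le ENNReal.ofReal_ne_top ENNReal.ofReal_ne_top hcont (hw i)).trans
            (by gcongr)
      _ = _ := by
          simp only [hsSq]
          rw [← Finset.mul_sum, Finset.sum_add_distrib, ← Finset.mul_sum]
          rfl
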